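/- Let $1<p<\infty$ and $p\le r<\infty$. Let $(X,\mu)$ and $(Y,\nu)$ be nonatomic $\sigma$-finite measure spaces with $\mu(X)=\nu(Y)=\infty$, and let $(Y,\nu)$ be separable (there are countably many measurable sets approximating every measurable set $E$ of finite measure arbitrarily well in the metric $\nu(E\triangle F)$). Let $\Phi_1,\Phi_2$ be Young functions, i.e. $\Phi_i(t)=\int_0^t\phi_i(s)\,ds$ with $\phi_i:(0,\infty)\to[0,\infty]$ increasing, left-continuous, $\phi_i(0^+)=0$, and neither identically zero nor identically infinite; put $\Phi_i(\infty)=\lim_{t\to\infty}\Phi_i(t)$. For a measurable function $f$ (scalar-valued, or with values in $[0,\infty]$) let $f^*(t)=\inf\{s>0:\mu(\{|f|>s\})\le t\}$, $t>0$, be its decreasing rearrangement; let $L_{\Phi}(\mu)$ be the set of measurable scalar-valued $f$ with $\int\Phi(k|f|)\,d\mu<\infty$ for some $k>0$, and $\|f\|_{L_\Phi(\mu)}=\inf\{\lambda>0:\int\Phi(|f|/\lambda)\,d\mu\le1\}$ (and similarly for $\nu$). Put $$|f|_{p,r}=\Big(\int_0^\infty\mu(\{|f|>t\})^{r/p}t^{r-1}\,dt\Big)^{1/r},\qquad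 (H^{p,r}g)(t)=\Big(t^{-r/p}\int_0^t g(s)^r s^{r/p-1}\,ds\Big)^{1/r}\quad(t>0),$$ let $S(\mu)$ be the set of measurable simple functions on $X$, and let $L_{p,r}(\mu)=\{f:|f|_{p,r}<\infty\}$. Functions are identified if they agree almost everywhere. For $D=S(\mu)$ or $D=L_{p,r}(\mu)+L_\infty(\mu)$, let $W_D$ be the class of operators $T$ from $D$ into the $\nu$-measurable scalar-valued functions on $Y$ such that (a) there are $C>0$ and $0<c<1$ with $(T(f_1+f_2))^*(t)\le C\,[(Tf_1)^*(ct)+(Tf_2)^*(ct)]$ for all $f_1,f_2\in D$ and $t>0$; (b) there is $C>0$ with $\lambda\,\nu(\{|Tf|>\lambda\})^{1/p}\le C\,|f|_{p,r}$ for all $f\in D$ and $\lambda>0$; (c) there is $M>0$ with $\|Tf\|_{L_\infty(\nu)}\le M\|f\|_{L_\infty(\mu)}$ for all $f\in D$. Then the following are equivalent: (1) To each $T\in W_{S(\mu)}$ there corresponds $C>0$ such that $\|Tf\|_{L_{\Phi_1}(\nu)}\le C\|f\|_{L_{\Phi_2}(\mu)}$ for all $f\in S(\mu)\cap L_{\Phi_2}(\mu)$.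 (1') $L_{\Phi_2}(\mu)\subset L_{p,r}(\mu)+L_\infty(\mu)$, and to each $T\in W_{L_{p,r}(\mu)+L_\infty(\mu)}$ there corresponds $C>0$ such that $\|Tf\|_{L_{\Phi_1}(\nu)}\le C\|f\|_{L_{\Phi_2}(\mu)}$ for all $f\in L_{\Phi_2}(\mu)$. (2) There is $K>0$ such that $$\int_0^\infty\Phi_1\big((H^{p,r}f^*)(t)\big)\,dt\le\int_0^\infty\Phi_2(Kf^*(s))\,ds$$ for all measurable $f:(0,\infty)\to[0,\infty]$, where $f^*$ is taken with respect to Lebesgue measure. (3) There are $A,B>0$ such that, for all $t>0$, $$t^p\int_0^t\frac{\Phi_1(s)}{s^{p+1}}\,ds\le A\,\Phi_2(Bt).$$ In particular, the condition does not depend on $r\in[p,\infty)$. Moreover, (2)$\Leftrightarrow$(3), (3)$\Rightarrow$(1) and (3)$\Rightarrow$(1') hold without the assumption that $(X,\mu)$ is nonatomic. -/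

import Mathlib

open MeasureTheory Set Filter Topology
open scoped ENNReal

namespace OrliczInterp

noncomputable section

/-- The density `φ : (0,∞) → [0,∞]` of a Young function: increasing, left-continuous, with
`φ(0⁺) = 0`, neither identically zero nor identically infinite. Only the values of `φ` on `(0,∞)`
matter. -/
structure IsYoungDensity (φ : ℝ → ℝ≥0∞) : Prop where
  mono : MonotoneOn φ (Ioi 0)
  left_cont : ∀ t : ℝ, 0 < t → ContinuousWithinAt φ (Iio t) t
  zero_right : Tendsto φ (𝓝[>] 0) (𝓝 0)
  ne_zero : ∃ t : ℝ, 0 < t ∧ φ t ≠ 0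
  ne_top : ∃ t : ℝ, 0 < t ∧ φ t ≠ ∞

/-- `Φ` is a Young function: `Φ(t) = ∫₀ᵗ φ(s) ds` with `φ` as above. It is regarded as a function
on `[0,∞]`, so that `Φ(0) = 0` and `Φ(∞) = ∫₀^∞ φ(s) ds = lim_{t → ∞} Φ(t)`. -/
def IsYoungFunction (Φ : ℝ≥0∞ → ℝ≥0∞) : Prop :=
  ∃ φ : ℝ → ℝ≥0∞, IsYoungDensity φ ∧
    ∀ t : ℝ≥0∞, Φ t = ∫⁻ s in {s : ℝ | 0 < s ∧ ENNReal.ofReal s < t}, φ s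

/-- Lebesgue measure `m` on `ℝ₊ = (0,∞)`. -/
def lebPos : Measure ℝ := volume.restrict (Ioi 0)

section Functionals

variable {Z : Type*} [MeasurableSpace Z]

/-- Distribution function `s ↦ μ {x | f x > s}` of a function `f ≥ 0`
(applied to `|f|` for a scalar-valued `f`). -/
def distFun (μ : Measure Z) (f : Z → ℝ≥0∞) (s : ℝ≥0∞) : ℝ≥0∞ :=
  μ {x | s < f x}

/-- Decreasing rearrangement `f*(t) = inf {s > 0 : μ {f > s} ≤ t}`. Here `s = ∞` always belongs to
the set, which corresponds to the convention `inf ∅ = ∞`. -/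
def rearr (μ : Measure Z) (f : Z → ℝ≥0∞) (t : ℝ) : ℝ≥0∞ :=
  sInf {s : ℝ≥0∞ | 0 < s ∧ distFun μ f s ≤ ENNReal.ofReal t}

/-- `(∫₀^∞ μ {|f| > t}^{r/p} t^{r-1} dt)^{1/r}`. -/
def lorentzInt {𝕜 : Type*} [RCLike 𝕜] (p r : ℝ) (μ : Measure Z) (f : Z → 𝕜) : ℝ≥0∞ :=
  (∫⁻ t in Ioi (0 : ℝ), distFun μ (fun x => ‖f x‖ₑ) (ENNReal.ofReal t) ^ (r / p)
    * ENNReal.ofReal (t ^ (r - 1))) ^ (1 / r)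

/-- The gauge (Luxemburg) norm `inf {k > 0 : ∫ Φ(|f| / k) dμ ≤ 1}`, equal to `∞` when there is
no such `k`. -/
def gaugeNorm {𝕜 : Type*} [RCLike 𝕜] (Φ : ℝ≥0∞ → ℝ≥0∞) (μ : Measure Z) (f : Z → 𝕜) : ℝ≥0∞ :=
  sInf {k : ℝ≥0∞ | 0 < k ∧ k < ∞ ∧ ∫⁻ x, Φ (‖f x‖ₑ / k) ∂μ ≤ 1}

/-- The Orlicz class `L_Φ(μ)`: measurable `f` with `∫ Φ(k|f|) dμ < ∞` for some `k > 0`. -/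
def orliczClass (𝕜 : Type*) [RCLike 𝕜] (Φ : ℝ≥0∞ → ℝ≥0∞) (μ : Measure Z) :
    Set (Z →ₘ[μ] 𝕜) :=
  {f | ∃ k : ℝ, 0 < k ∧ ∫⁻ x, Φ (ENNReal.ofReal k * ‖f x‖ₑ) ∂μ < ∞}

/-- The (classes of) measurable simple functions `S(μ)`. -/
def simpleFunctions (𝕜 : Type*) [RCLike 𝕜] (μ : Measure Z) : Set (Z →ₘ[μ] 𝕜) :=
  range fun s : SimpleFunc Z 𝕜 => AEEqFun.mk s s.aestronglyMeasurable

/-- The sum `L_{p,r}(μ) + L_∞(μ)`. -/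
def lorentzSumLinfty (𝕜 : Type*) [RCLike 𝕜] (p r : ℝ) (μ : Measure Z) : Set (Z →ₘ[μ] 𝕜) :=
  {f | ∃ g h : Z →ₘ[μ] 𝕜, f = g + h ∧ lorentzInt p r μ g < ∞ ∧ eLpNorm h ∞ μ < ∞}

/-- Every measurable set of positive measure has a measurable subset of strictly smaller positive
measure. -/
def IsNonatomic (μ : Measure Z) : Prop :=
  ∀ A, MeasurableSet A → 0 < μ A → ∃ B ⊆ A, MeasurableSet B ∧ 0 < μ B ∧ μ B < μ A

end Functionals

section Operators

variable {X Y 𝕜 : Type*} [MeasurableSpace X] [MeasurableSpace Y] [RCLike 𝕜]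
  {μ : Measure X} {ν : Measure Y}

/-- The class `W((p,r),(∞,∞);μ,ν)` for operators with domain `D`: `T` maps `D` into the measurable
functions on `Y`, is `r`-quasilinear, satisfies the weak-type `(p,r)` estimate, and is bounded from
`L_∞(μ)` to `L_∞(ν)`. Values of `T` outside `D` are irrelevant. -/
structure MemW (D : Set (X →ₘ[μ] 𝕜)) (p r : ℝ) (T : (X →ₘ[μ] 𝕜) → (Y →ₘ[ν] 𝕜)) : Prop where
  quasilinear : ∃ C c : ℝ, 0 < C ∧ 0 < c ∧ c < 1 ∧ ∀ f₁ ∈ D, ∀ f₂ ∈ D, ∀ t : ℝ, 0 < t →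
    rearr ν (fun y => ‖T (f₁ + f₂) y‖ₑ) t ≤ ENNReal.ofReal C *
      (rearr ν (fun y => ‖T f₁ y‖ₑ) (c * t) + rearr ν (fun y => ‖T f₂ y‖ₑ) (c * t))
  weak_type : ∃ C : ℝ, 0 < C ∧ ∀ f ∈ D, ∀ l : ℝ, 0 < l →
    ENNReal.ofReal l * distFun ν (fun y => ‖T f y‖ₑ) (ENNReal.ofReal l) ^ (1 / p)
      ≤ ENNReal.ofReal C * lorentzInt p r μ f
  bounded : ∃ M : ℝ, 0 < M ∧ ∀ f ∈ D, eLpNorm (T f) ∞ ν ≤ ENNReal.ofReal M * eLpNorm f ∞ μ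

/-- Every `T` of class `W` with domain `D` is bounded from `L_{Φ₂}(μ)` to `L_{Φ₁}(ν)`, as far as
it is defined: `‖T f‖ ≤ C ‖f‖` for `f ∈ D ∩ L_{Φ₂}(μ)`, with `C` depending on `T` only. -/
def BoundedOn (D : Set (X →ₘ[μ] 𝕜)) (ν : Measure Y) (p r : ℝ) (Φ₁ Φ₂ : ℝ≥0∞ → ℝ≥0∞) : Prop :=
  ∀ T : (X →ₘ[μ] 𝕜) → (Y →ₘ[ν] 𝕜), MemW D p r T →
    ∃ C : ℝ, 0 < C ∧ ∀ f ∈ D, f ∈ orliczClass 𝕜 Φ₂ μ →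
      gaugeNorm Φ₁ ν (T f) ≤ ENNReal.ofReal C * gaugeNorm Φ₂ μ f

/-- Boundedness for the operators defined on simple functions. -/
def BoundedSimple (𝕜 : Type*) [RCLike 𝕜] (μ : Measure X) (ν : Measure Y) (p r : ℝ)
    (Φ₁ Φ₂ : ℝ≥0∞ → ℝ≥0∞) : Prop :=
  BoundedOn (simpleFunctions 𝕜 μ) ν p r Φ₁ Φ₂

/-- Boundedness on all of `L_{Φ₂}(μ)` for the operators defined on `L_{p,r}(μ) + L_∞(μ)`; that
they are defined on `L_{Φ₂}(μ)` is part of the assertion. -/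
def BoundedFull (𝕜 : Type*) [RCLike 𝕜] (μ : Measure X) (ν : Measure Y) (p r : ℝ)
    (Φ₁ Φ₂ : ℝ≥0∞ → ℝ≥0∞) : Prop :=
  orliczClass 𝕜 Φ₂ μ ⊆ lorentzSumLinfty 𝕜 p r μ ∧
    BoundedOn (lorentzSumLinfty 𝕜 p r μ) ν p r Φ₁ Φ₂

end Operators

/-- The Calderón operator `(H^{p,r} g)(t) = (t^{-r/p} ∫₀ᵗ g(s)^r s^{r/p-1} ds)^{1/r}`, `t > 0`. -/
def calderonH (p r : ℝ) (g : ℝ → ℝ≥0∞) (t : ℝ) : ℝ≥0∞ :=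
  (ENNReal.ofReal (t ^ (-(r / p))) *
    ∫⁻ s in Ioo 0 t, g s ^ r * ENNReal.ofReal (s ^ (r / p - 1))) ^ (1 / r)

/-- The modular inequality `∫ Φ₁(H^{p,r} f*) ≤ ∫ Φ₂(K f*)`, with `K > 0` independent of the
nonnegative measurable function `f` on `ℝ₊`. -/
def ModularInequality (p r : ℝ) (Φ₁ Φ₂ : ℝ≥0∞ → ℝ≥0∞) : Prop :=
  ∃ K : ℝ, 0 < K ∧ ∀ f : ℝ → ℝ≥0∞, AEMeasurable f lebPos →
    ∫⁻ t, Φ₁ (calderonH p r (rearr lebPos f) t) ∂lebPos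
      ≤ ∫⁻ s, Φ₂ (ENNReal.ofReal K * rearr lebPos f s) ∂lebPos

/-- The Zygmund–Strömberg condition `t^p ∫₀ᵗ Φ₁(s) / s^{p+1} ds ≤ A Φ₂(B t)` for all `t > 0`. -/
def ZygmundStromberg (p : ℝ) (Φ₁ Φ₂ : ℝ≥0∞ → ℝ≥0∞) : Prop :=
  ∃ A B : ℝ, 0 < A ∧ 0 < B ∧ ∀ t : ℝ, 0 < t →
    ENNReal.ofReal (t ^ p) *
        ∫⁻ s in Ioo 0 t, Φ₁ (ENNReal.ofReal s) / ENNReal.ofReal (s ^ (p + 1))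
      ≤ ENNReal.ofReal A * Φ₂ (ENNReal.ofReal (B * t))

end

end OrliczInterp

/-! Everything passes through `DensityCondition`, the form `t^p ∫₀ᵗ φ₁(s)/s^p ds ≤ A Φ₂(Bt)` of
condition (3). The two are equivalent because `Φ₁(t) ≤ t φ₁(t) ≤ Φ₁(2t)`.

Sufficiency. Suppose `ν{G > u} ≤ C u^{-p} ∫_{F > u} F^p` for all `u > 0`. Inserting this in the
layer cake formula `∫ Φ₁(G) = ∫ φ₁(u) ν{G > u} du` and applying Tonelli leaves `C ∫ F^p (∫₀^F
φ₁(u)/u^p du) ≤ CA ∫ Φ₂(BF)`; convexity moves the constant inside `Φ₂`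
(`DensityCondition.lintegral_young_le`). The truncated estimate holds, up to constants, for `F =
2f*`, `G = H^{p,r} f*` (`lebPos_lt_calderonH_le`), and for `F = |f|`, `G = |Tf|` by cutting `f` at
height `u`: the weak-type bound controls the large part, the `L_∞` bound the rest
(`MemW.distribution_le`). Since `p ≤ r`, both `H^{p,r}` on decreasing functions and `|·|_{p,r}` are
dominated by their analogues for `r = p`, so `r` disappears.

Necessity. If `ν{G > u} ≥ c (b/u)^p` for `u < b`, the layer cake formula bounds `∫ Φ₁(G)` below by
`c b^p ∫₀ᵇ φ₁(s)/s^p ds`. For the Calderón operator such a `G` comes from a multiple of the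
indicator of `(0,1)`. For the class `W` it comes from one extremal operator, `f ↦ sup_l l min(1,
(μ{|f| > l}/τ)^{1/p})`, tested on `a χ_E`; here `τ` on `Y` has distribution comparable to Lebesgue
measure on `(0,∞)`, and exists because `ν` is nonatomic. Nonatomicity of `μ` supplies sets `E` of
any prescribed approximate measure. -/

namespace OrliczInterp

/-! ### Young functions and their densities -/

/-- A globally monotone density `φ` representing `Φ` through `Φ(t) = ∫_{0 < s < t} φ(s) ds`. -/
structure IsMonotoneDensity (φ : ℝ → ℝ≥0∞) (Φ : ℝ≥0∞ → ℝ≥0∞) : Prop where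
  mono : Monotone φ
  ne_zero : ∃ t : ℝ, 0 < t ∧ φ t ≠ 0
  eq : ∀ t : ℝ≥0∞, Φ t = ∫⁻ s in Ioi (0 : ℝ), {s : ℝ | ENNReal.ofReal s < t}.indicator φ s

theorem measurableSet_ofReal_lt (t : ℝ≥0∞) : MeasurableSet {s : ℝ | ENNReal.ofReal s < t} :=
  measurableSet_lt ENNReal.measurable_ofReal measurable_const

/-- Extension by zero to the nonpositive half-line makes the density monotone on all of `ℝ`, hence
measurable. -/
theorem IsYoungFunction.exists_density {Φ : ℝ≥0∞ → ℝ≥0∞} (h : IsYoungFunction Φ) :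
    ∃ φ, IsMonotoneDensity φ Φ := by
  obtain ⟨φ, hφ, hΦ⟩ := h
  refine ⟨(Ioi 0).indicator φ, ⟨?_, ?_, fun t => ?_⟩⟩
  · intro x y hxy
    by_cases hx : 0 < x
    · have hy : 0 < y := hx.trans_le hxy
      simpa [indicator, hx, hy] using hφ.mono hx hy hxy
    · simp [indicator, hx]
  · obtain ⟨t, ht, h⟩ := hφ.ne_zero
    exact ⟨t, ht, by simpa [indicator, ht] using h⟩
  · have hset : {s : ℝ | 0 < s ∧ ENNReal.ofReal s < t}
        = {s : ℝ | ENNReal.ofReal s < t} ∩ Ioi 0 := by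
      ext s; simp [and_comm]
    rw [hΦ, lintegral_indicator (measurableSet_ofReal_lt t),
      Measure.restrict_restrict (measurableSet_ofReal_lt t), hset]
    refine setLIntegral_congr_fun ((measurableSet_ofReal_lt t).inter measurableSet_Ioi) ?_
    intro s hs
    exact (indicator_of_mem hs.2 φ).symm

/-- Scaling of the Lebesgue integral over `(0,∞)`. -/
theorem lintegral_Ioi_scale {a : ℝ} (ha : 0 < a) (g : ℝ → ℝ≥0∞) :
    ∫⁻ s in Ioi (0 : ℝ), g s = ENNReal.ofReal a * ∫⁻ s in Ioi (0 : ℝ), g (a * s) := by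
  have himg : (fun s : ℝ => a * s) '' Ioi 0 = Ioi 0 := by
    rw [image_mul_left_Ioi ha, mul_zero]
  have h := lintegral_image_eq_lintegral_abs_deriv_mul (s := Ioi (0 : ℝ)) (f := fun s => a * s)
    (f' := fun _ => a) measurableSet_Ioi
    (fun x _ => by simpa using ((hasDerivAt_id x).const_mul a).hasDerivWithinAt)
    (fun x _ y _ hxy => mul_left_cancel₀ ha.ne' hxy) g
  rw [himg] at h
  rw [h, lintegral_const_mul' _ _ ENNReal.ofReal_ne_top, abs_of_pos ha]

theorem setLIntegral_Ioo_eq_indicator (t : ℝ) (g : ℝ → ℝ≥0∞) :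
    ∫⁻ s in Ioo 0 t, g s = ∫⁻ s in Ioi (0 : ℝ), (Iio t).indicator g s := by
  rw [lintegral_indicator measurableSet_Iio, Measure.restrict_restrict measurableSet_Iio,
    inter_comm, Ioi_inter_Iio]

theorem setLIntegral_Ioo_eq_indicator_ofReal (t : ℝ) (g : ℝ → ℝ≥0∞) :
    ∫⁻ s in Ioo 0 t, g s
      = ∫⁻ s in Ioi (0 : ℝ), {s : ℝ | ENNReal.ofReal s < ENNReal.ofReal t}.indicator g s := by
  rw [setLIntegral_Ioo_eq_indicator]
  refine setLIntegral_congr_fun measurableSet_Ioi fun s hs => ?_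
  have hs0 : 0 < s := hs
  by_cases hst : s < t
  · rw [indicator_of_mem (by exact hst),
      indicator_of_mem (by exact (ENNReal.ofReal_lt_ofReal_iff (hs0.trans hst)).2 hst)]
  · have : ¬ ENNReal.ofReal s < ENNReal.ofReal t :=
      not_lt.2 (ENNReal.ofReal_le_ofReal (not_lt.1 hst))
    rw [indicator_of_notMem (show s ∉ Iio t from hst),
      indicator_of_notMem (show s ∉ {s : ℝ | ENNReal.ofReal s < ENNReal.ofReal t} from this)]

namespace IsMonotoneDensity

variable {φ : ℝ → ℝ≥0∞} {Φ : ℝ≥0∞ → ℝ≥0∞}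

theorem young_mono (h : IsMonotoneDensity φ Φ) : Monotone Φ := by
  intro s t hst
  rw [h.eq, h.eq]
  refine lintegral_mono fun u => ?_
  exact indicator_le_indicator_of_subset (fun v hv => lt_of_lt_of_le hv hst) (fun _ => zero_le) u

theorem young_zero (h : IsMonotoneDensity φ Φ) : Φ 0 = 0 := by
  rw [h.eq]; simp

theorem young_top (h : IsMonotoneDensity φ Φ) : Φ ∞ = ∞ := by
  obtain ⟨t, ht, hne⟩ := h.ne_zero
  rw [h.eq, eq_top_iff]
  calc ∞ = ∫⁻ _ in Ioi t, φ t := by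
        rw [setLIntegral_const, Real.volume_Ioi, ENNReal.mul_top hne]
    _ ≤ ∫⁻ s in Ioi t, φ s := setLIntegral_mono' measurableSet_Ioi fun s hs => h.mono (le_of_lt hs)
    _ ≤ ∫⁻ s in Ioi (0 : ℝ), φ s := lintegral_mono_set (Ioi_subset_Ioi ht.le)
    _ = _ := by simp

/-- Rescaling gives `Φ(At) = A ∫₀ᵗ φ(As) ds`, and `φ(As) ≥ φ(s)`. This is how multiplicative
constants are absorbed into the argument of `Φ₂`. -/
theorem mul_young_le (h : IsMonotoneDensity φ Φ) {A : ℝ} (hA : 1 ≤ A) (t : ℝ≥0∞) :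
    ENNReal.ofReal A * Φ t ≤ Φ (ENNReal.ofReal A * t) := by
  have hA0 : 0 < A := by linarith
  rw [h.eq, h.eq (ENNReal.ofReal A * t), lintegral_Ioi_scale hA0
    ({s : ℝ | ENNReal.ofReal s < ENNReal.ofReal A * t}.indicator φ)]
  refine mul_le_mul_right ?_ _
  refine setLIntegral_mono' measurableSet_Ioi fun s hs => ?_
  have hs0 : 0 < s := hs
  by_cases hst : ENNReal.ofReal s < t
  · have hst' : ENNReal.ofReal (A * s) < ENNReal.ofReal A * t := by
      rw [ENNReal.ofReal_mul hA0.le]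
      exact (ENNReal.mul_lt_mul_iff_right (by simpa using hA0) ENNReal.ofReal_ne_top).2 hst
    rw [indicator_of_mem (by exact hst), indicator_of_mem (by exact hst')]
    exact h.mono (by nlinarith)
  · rw [indicator_of_notMem (by exact hst)]
    exact zero_le

theorem young_ofReal (h : IsMonotoneDensity φ Φ) (t : ℝ) :
    Φ (ENNReal.ofReal t) = ∫⁻ s in Ioo 0 t, φ s := by
  rw [h.eq, setLIntegral_Ioo_eq_indicator_ofReal]

theorem young_le_mul (h : IsMonotoneDensity φ Φ) (t : ℝ) :
    Φ (ENNReal.ofReal t) ≤ ENNReal.ofReal t * φ t := by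
  rw [h.young_ofReal]
  calc ∫⁻ s in Ioo 0 t, φ s ≤ ∫⁻ _ in Ioo 0 t, φ t :=
        setLIntegral_mono' measurableSet_Ioo fun s hs => h.mono hs.2.le
    _ = _ := by rw [setLIntegral_const, Real.volume_Ioo, sub_zero, mul_comm]

theorem mul_le_young (h : IsMonotoneDensity φ Φ) {t : ℝ} (ht : 0 < t) :
    ENNReal.ofReal t * φ t ≤ Φ (ENNReal.ofReal (2 * t)) := by
  rw [h.young_ofReal]
  calc ENNReal.ofReal t * φ t = ∫⁻ _ in Ico t (2 * t), φ t := by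
        rw [setLIntegral_const, Real.volume_Ico, mul_comm]; congr 2; ring
    _ ≤ ∫⁻ s in Ico t (2 * t), φ s := setLIntegral_mono' measurableSet_Ico fun s hs => h.mono hs.1
    _ ≤ _ := lintegral_mono_set fun s hs => show s ∈ Ioo 0 (2 * t) from ⟨ht.trans_le hs.1, hs.2⟩

/-- Layer cake formula for a Young function. -/
theorem lintegral_young {Z : Type*} [MeasurableSpace Z] {ν : Measure Z} [SFinite ν]
    (h : IsMonotoneDensity φ Φ) {G : Z → ℝ≥0∞} (hG : Measurable G) :
    ∫⁻ y, Φ (G y) ∂ν = ∫⁻ u in Ioi (0 : ℝ), φ u * ν {y | ENNReal.ofReal u < G y} := by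
  simp_rw [h.eq]
  have hset : MeasurableSet {q : Z × ℝ | ENNReal.ofReal q.2 < G q.1} :=
    measurableSet_lt (ENNReal.measurable_ofReal.comp measurable_snd) (hG.comp measurable_fst)
  have hm : Measurable (Function.uncurry fun (y : Z) (s : ℝ) =>
      {s : ℝ | ENNReal.ofReal s < G y}.indicator φ s) :=
    (h.mono.measurable.comp measurable_snd).indicator hset
  rw [lintegral_lintegral_swap hm.aemeasurable]
  refine lintegral_congr fun u => ?_
  have : ∀ y, {s : ℝ | ENNReal.ofReal s < G y}.indicator φ u
      = {y | ENNReal.ofReal u < G y}.indicator (fun _ => φ u) y := fun y => by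
    simp [indicator]
  simp_rw [this]
  rw [lintegral_indicator_const (measurableSet_lt measurable_const hG)]

/-- Apply `s φ(s) ≤ Φ(2s)` under the integral and substitute `s ↦ 2s`; the factor `2^(p+1)` comes
from `(2s)^(p+1)`, and the Jacobian `2` is simply discarded. -/
theorem lintegral_div_rpow_le_young (h : IsMonotoneDensity φ Φ) (p t : ℝ) :
    ∫⁻ s in Ioo 0 t, φ s / ENNReal.ofReal (s ^ p) ≤ ENNReal.ofReal (2 ^ (p + 1)) *
      ∫⁻ s in Ioo 0 (2 * t), Φ (ENNReal.ofReal s) / ENNReal.ofReal (s ^ (p + 1)) := by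
  rw [setLIntegral_Ioo_eq_indicator, setLIntegral_Ioo_eq_indicator,
    lintegral_Ioi_scale (two_pos : (0 : ℝ) < 2)
      ((Iio (2 * t)).indicator _), ← mul_assoc,
    ← lintegral_const_mul' _ _ (ENNReal.mul_ne_top ENNReal.ofReal_ne_top ENNReal.ofReal_ne_top)]
  refine setLIntegral_mono' measurableSet_Ioi fun s hs => ?_
  have hs0 : 0 < s := hs
  by_cases hst : s < t
  · rw [indicator_of_mem (by exact hst), indicator_of_mem (by simpa using hst)]
    have e : ENNReal.ofReal ((2 * s) ^ (p + 1))
        = ENNReal.ofReal (2 ^ (p + 1)) * (ENNReal.ofReal (s ^ p) * ENNReal.ofReal s) := by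
      rw [Real.mul_rpow two_pos.le hs0.le, Real.rpow_add_one hs0.ne', ENNReal.ofReal_mul
        (by positivity), ENNReal.ofReal_mul (by positivity)]
    have h1 := h.mul_le_young hs0
    have hc : ENNReal.ofReal (2 ^ (p + 1)) ≠ 0 := by
      simpa using Real.rpow_pos_of_pos two_pos (p + 1)
    have hsp : ENNReal.ofReal (s ^ p) ≠ 0 := by simpa using Real.rpow_pos_of_pos hs0 p
    have hs1 : ENNReal.ofReal s ≠ 0 := by simpa using hs0
    calc φ s / ENNReal.ofReal (s ^ p)
        = ENNReal.ofReal (2 ^ (p + 1)) *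
          ((ENNReal.ofReal s * φ s) / ENNReal.ofReal ((2 * s) ^ (p + 1))) := by
          rw [e, ← mul_div_assoc, ENNReal.mul_div_mul_left _ _ hc ENNReal.ofReal_ne_top,
            mul_comm (ENNReal.ofReal s), ENNReal.mul_div_mul_right _ _ hs1 ENNReal.ofReal_ne_top]
      _ ≤ ENNReal.ofReal (2 ^ (p + 1)) * ENNReal.ofReal 2 *
          (Φ (ENNReal.ofReal (2 * s)) / ENNReal.ofReal ((2 * s) ^ (p + 1))) := by
          gcongr
          exact le_mul_of_one_le_right (zero_le) (by simp)
  · rw [indicator_of_notMem (by exact hst)]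
    exact zero_le

theorem lintegral_young_div_rpow_le (h : IsMonotoneDensity φ Φ) (p t : ℝ) :
    ∫⁻ s in Ioo 0 t, Φ (ENNReal.ofReal s) / ENNReal.ofReal (s ^ (p + 1))
      ≤ ∫⁻ s in Ioo 0 t, φ s / ENNReal.ofReal (s ^ p) := by
  refine setLIntegral_mono' measurableSet_Ioo fun s hs => ?_
  have hs0 : 0 < s := hs.1
  have hs1 : ENNReal.ofReal s ≠ 0 := by simpa using hs0
  calc Φ (ENNReal.ofReal s) / ENNReal.ofReal (s ^ (p + 1))
      ≤ (ENNReal.ofReal s * φ s) / ENNReal.ofReal (s ^ (p + 1)) := by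
        gcongr; exact h.young_le_mul s
    _ = φ s / ENNReal.ofReal (s ^ p) := by
        rw [Real.rpow_add_one hs0.ne', ENNReal.ofReal_mul (by positivity),
          mul_comm (ENNReal.ofReal s), ENNReal.mul_div_mul_right _ _ hs1 ENNReal.ofReal_ne_top]

end IsMonotoneDensity

/-! ### The density condition and the modular inequality it implies -/

/-- The Zygmund–Strömberg condition in terms of a density of `Φ₁`. -/
def DensityCondition (p : ℝ) (φ₁ : ℝ → ℝ≥0∞) (Φ₂ : ℝ≥0∞ → ℝ≥0∞) : Prop :=
  ∃ A B : ℝ, 0 < A ∧ 0 < B ∧ ∀ t : ℝ, 0 < t →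
    ENNReal.ofReal (t ^ p) * ∫⁻ s in Ioo 0 t, φ₁ s / ENNReal.ofReal (s ^ p)
      ≤ ENNReal.ofReal A * Φ₂ (ENNReal.ofReal (B * t))

theorem DensityCondition.zygmundStromberg {p : ℝ} {φ₁ : ℝ → ℝ≥0∞} {Φ₁ Φ₂ : ℝ≥0∞ → ℝ≥0∞}
    (h₁ : IsMonotoneDensity φ₁ Φ₁) (h : DensityCondition p φ₁ Φ₂) : ZygmundStromberg p Φ₁ Φ₂ := by
  obtain ⟨A, B, hA, hB, h⟩ := h
  refine ⟨A, B, hA, hB, fun t ht => le_trans ?_ (h t ht)⟩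
  exact mul_le_mul_right (h₁.lintegral_young_div_rpow_le p t) _

theorem ZygmundStromberg.densityCondition {p : ℝ} (hp : 0 < p) {φ₁ : ℝ → ℝ≥0∞}
    {Φ₁ Φ₂ : ℝ≥0∞ → ℝ≥0∞} (h₁ : IsMonotoneDensity φ₁ Φ₁) (h : ZygmundStromberg p Φ₁ Φ₂) :
    DensityCondition p φ₁ Φ₂ := by
  obtain ⟨A, B, hA, hB, h⟩ := h
  refine ⟨2 ^ (p + 1) * A, B * 2, by positivity, by positivity, fun t ht => ?_⟩
  have h2 := h (2 * t) (by positivity)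
  calc _ ≤ ENNReal.ofReal ((2 * t) ^ p) * (ENNReal.ofReal (2 ^ (p + 1)) *
      ∫⁻ s in Ioo 0 (2 * t), Φ₁ (ENNReal.ofReal s) / ENNReal.ofReal (s ^ (p + 1))) := by
        exact mul_le_mul' (ENNReal.ofReal_le_ofReal (by gcongr; linarith)) (h₁.lintegral_div_rpow_le_young p t)
    _ ≤ _ := by
        rw [mul_left_comm, ENNReal.ofReal_mul (by positivity), mul_assoc, mul_assoc B]
        gcongr

instance : SigmaFinite lebPos := by unfold lebPos; infer_instance

/-- The endpoints must be included because the functions integrated later take values in `[0,∞]`: at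
`0` the left side vanishes, at `∞` the right side is infinite. -/
theorem rpow_mul_lintegral_density_le_young {p A B : ℝ} (hp : 0 < p) (hA : 0 < A) (hB : 0 < B)
    {φ₁ : ℝ → ℝ≥0∞} {Φ₂ : ℝ≥0∞ → ℝ≥0∞} (htop : Φ₂ ∞ = ∞)
    (h : ∀ t : ℝ, 0 < t →
      ENNReal.ofReal (t ^ p) * ∫⁻ s in Ioo 0 t, φ₁ s / ENNReal.ofReal (s ^ p)
        ≤ ENNReal.ofReal A * Φ₂ (ENNReal.ofReal (B * t))) (x : ℝ≥0∞) :
    x ^ p * ∫⁻ u in Ioi (0 : ℝ), {u : ℝ | ENNReal.ofReal u < x}.indicator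
        (fun u => φ₁ u / ENNReal.ofReal (u ^ p)) u
      ≤ ENNReal.ofReal A * Φ₂ (ENNReal.ofReal B * x) := by
  rcases eq_or_ne x ∞ with rfl | hx
  · rw [ENNReal.mul_top (by simpa using hB), htop, ENNReal.mul_top (by simpa using hA)]
    exact le_top
  · obtain ⟨t, ht, rfl⟩ : ∃ t : ℝ, 0 ≤ t ∧ x = ENNReal.ofReal t :=
      ⟨x.toReal, ENNReal.toReal_nonneg, (ENNReal.ofReal_toReal hx).symm⟩
    rcases ht.eq_or_lt with rfl | ht
    · simp [ENNReal.zero_rpow_of_pos hp]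
    · rw [← setLIntegral_Ioo_eq_indicator_ofReal, ENNReal.ofReal_rpow_of_pos ht,
        ← ENNReal.ofReal_mul hB.le]
      exact h t ht

/-- A weak-type estimate with a truncated right-hand side upgrades to a modular inequality. -/
theorem DensityCondition.lintegral_young_le {Z Z' : Type*} [MeasurableSpace Z]
    [MeasurableSpace Z'] {μ : Measure Z} {ν : Measure Z'} [SFinite μ] [SFinite ν] {p : ℝ}
    (hp : 0 < p) {φ₁ φ₂ : ℝ → ℝ≥0∞} {Φ₁ Φ₂ : ℝ≥0∞ → ℝ≥0∞} (h₁ : IsMonotoneDensity φ₁ Φ₁)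
    (h₂ : IsMonotoneDensity φ₂ Φ₂) (h : DensityCondition p φ₁ Φ₂) {C : ℝ} (hC : 0 < C) :
    ∃ K : ℝ, 0 < K ∧ ∀ (F : Z → ℝ≥0∞) (G : Z' → ℝ≥0∞), Measurable F → Measurable G →
      (∀ u : ℝ, 0 < u → ν {y | ENNReal.ofReal u < G y} ≤ ENNReal.ofReal C *
        (ENNReal.ofReal (u ^ p))⁻¹ * ∫⁻ x, {x | ENNReal.ofReal u < F x}.indicator
          (fun x => F x ^ p) x ∂μ) →
      ∫⁻ y, Φ₁ (G y) ∂ν ≤ ∫⁻ x, Φ₂ (ENNReal.ofReal K * F x) ∂μ := by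
  obtain ⟨A, B, hA, hB, h⟩ := h
  -- `CA` is the constant in front of `Φ₂(BF)` after Tonelli; `mul_young_le` absorbs it only when it
  -- is at least `1`, hence the maximum.
  refine ⟨max (C * A) 1 * B, by positivity, fun F G hF hG hFG => ?_⟩
  rw [h₁.lintegral_young hG]
  have hm1 : Measurable fun u : ℝ => φ₁ u / ENNReal.ofReal (u ^ p) :=
    h₁.mono.measurable.div (by fun_prop)
  have hset : MeasurableSet {q : ℝ × Z | ENNReal.ofReal q.1 < F q.2} :=
    measurableSet_lt (ENNReal.measurable_ofReal.comp measurable_fst) (hF.comp measurable_snd)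
  calc ∫⁻ u in Ioi (0 : ℝ), φ₁ u * ν {y | ENNReal.ofReal u < G y}
      ≤ ∫⁻ u in Ioi (0 : ℝ), ∫⁻ x, {q : ℝ × Z | ENNReal.ofReal q.1 < F q.2}.indicator
          (fun q => ENNReal.ofReal C * (φ₁ q.1 / ENNReal.ofReal (q.1 ^ p)) * F q.2 ^ p)
            (u, x) ∂μ := by
        refine setLIntegral_mono' measurableSet_Ioi fun u hu => ?_
        calc φ₁ u * ν {y | ENNReal.ofReal u < G y} ≤ φ₁ u * _ :=
              mul_le_mul_right (hFG u hu) _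
          _ = ENNReal.ofReal C * (φ₁ u / ENNReal.ofReal (u ^ p)) *
              ∫⁻ x, {x | ENNReal.ofReal u < F x}.indicator (fun x => F x ^ p) x ∂μ := by
            rw [div_eq_mul_inv]; ring
          _ = _ := by
            rw [← lintegral_const_mul _ ((hF.pow_const p).indicator
              (measurableSet_lt measurable_const hF))]
            refine lintegral_congr fun x => ?_
            simp [indicator]
    _ = ∫⁻ x, (∫⁻ u in Ioi (0 : ℝ), {q : ℝ × Z | ENNReal.ofReal q.1 < F q.2}.indicator
          (fun q => ENNReal.ofReal C * (φ₁ q.1 / ENNReal.ofReal (q.1 ^ p)) * F q.2 ^ p)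
            (u, x)) ∂μ := by
        refine lintegral_lintegral_swap (Measurable.aemeasurable ?_)
        exact Measurable.indicator ((measurable_const.mul (hm1.comp measurable_fst)).mul
          ((hF.comp measurable_snd).pow_const p)) hset
    _ ≤ ∫⁻ x, Φ₂ (ENNReal.ofReal (max (C * A) 1 * B) * F x) ∂μ := by
        refine lintegral_mono fun x => ?_
        have hpt : ∀ u : ℝ, {q : ℝ × Z | ENNReal.ofReal q.1 < F q.2}.indicator
            (fun q => ENNReal.ofReal C * (φ₁ q.1 / ENNReal.ofReal (q.1 ^ p)) * F q.2 ^ p) (u, x)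
            = ENNReal.ofReal C * F x ^ p * {u : ℝ | ENNReal.ofReal u < F x}.indicator
              (fun u => φ₁ u / ENNReal.ofReal (u ^ p)) u := fun u => by
          by_cases hu : ENNReal.ofReal u < F x
          · simp only [indicator, mem_ofPred_eq, hu, if_true]; ring
          · simp [indicator, hu]
        simp_rw [hpt]
        rw [lintegral_const_mul _ (hm1.indicator (measurableSet_ofReal_lt _)), mul_assoc]
        calc _ ≤ ENNReal.ofReal C * (ENNReal.ofReal A * Φ₂ (ENNReal.ofReal B * F x)) :=
              mul_le_mul_right (rpow_mul_lintegral_density_le_young hp hA hB h₂.young_top h _) _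
          _ = ENNReal.ofReal (C * A) * Φ₂ (ENNReal.ofReal B * F x) := by
              rw [ENNReal.ofReal_mul hC.le, mul_assoc]
          _ ≤ ENNReal.ofReal (max (C * A) 1) * Φ₂ (ENNReal.ofReal B * F x) := by
              gcongr; exact le_max_left _ _
          _ ≤ _ := by
              rw [ENNReal.ofReal_mul (by positivity), mul_assoc]
              exact h₂.mul_young_le (le_max_right _ _) _

/-- The tool for necessity: keep only the levels `u < b` in the layer cake formula. -/
theorem IsMonotoneDensity.mul_lintegral_density_le {Z : Type*} [MeasurableSpace Z]
    {ν : Measure Z} [SFinite ν] {φ : ℝ → ℝ≥0∞} {Φ : ℝ≥0∞ → ℝ≥0∞} (h : IsMonotoneDensity φ Φ)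
    {G : Z → ℝ≥0∞} (hG : Measurable G) {p b : ℝ} (c : ℝ≥0∞)
    (hν : ∀ u : ℝ, 0 < u → u < b →
      c * ENNReal.ofReal ((b / u) ^ p) ≤ ν {y | ENNReal.ofReal u < G y}) :
    c * (ENNReal.ofReal (b ^ p) * ∫⁻ s in Ioo 0 b, φ s / ENNReal.ofReal (s ^ p))
      ≤ ∫⁻ y, Φ (G y) ∂ν := by
  rw [h.lintegral_young hG]
  have hm1 : Measurable fun u : ℝ => φ u / ENNReal.ofReal (u ^ p) :=
    h.mono.measurable.div (by fun_prop)
  rw [← mul_assoc, ← lintegral_const_mul _ hm1]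
  refine le_trans ?_ (lintegral_mono_set (show Ioo 0 b ⊆ Ioi 0 from fun x hx => hx.1))
  refine setLIntegral_mono' measurableSet_Ioo fun u hu => ?_
  have hu0 : 0 < u := hu.1
  have hb : 0 < b := hu.1.trans hu.2
  refine le_trans (le_of_eq ?_) (mul_le_mul_right (hν u hu.1 hu.2) _)
  rw [Real.div_rpow hb.le hu0.le, ENNReal.ofReal_div_of_pos (Real.rpow_pos_of_pos hu0 p),
    div_eq_mul_inv, div_eq_mul_inv]
  ring

/-! ### The Calderón operator and the modular inequality -/

section Calderon

theorem calderonH_measurable (p r : ℝ) (g : ℝ → ℝ≥0∞) : Measurable (calderonH p r g) := by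
  unfold calderonH
  refine Measurable.pow_const (Measurable.mul (by fun_prop) (Monotone.measurable ?_)) _
  exact fun s t hst => lintegral_mono_set (Ioo_subset_Ioo_right hst)

/-- Reduction to `r = p`. As `g` decreases, `s g(s)^p ≤ ∫₀ˢ g^p ≤ I`; now write `g^r s^{r/p-1} = g^p
(s g^p)^{r/p-1}` and bound the last factor by `I^{r/p-1}`. -/
theorem calderonH_le {p r : ℝ} (hp : 0 < p) (hpr : p ≤ r) {g : ℝ → ℝ≥0∞} (hg : Antitone g)
    {t : ℝ} (ht : 0 < t) :
    calderonH p r g t ≤ ((ENNReal.ofReal t)⁻¹ * ∫⁻ s in Ioo 0 t, g s ^ p) ^ (1 / p) := by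
  have hr : 0 < r := hp.trans_le hpr
  have hrp : 0 ≤ r / p - 1 := by rw [sub_nonneg, one_le_div hp]; exact hpr
  set I := ∫⁻ s in Ioo 0 t, g s ^ p with hI
  have key : ∫⁻ s in Ioo 0 t, g s ^ r * ENNReal.ofReal (s ^ (r / p - 1)) ≤ I ^ (r / p) := by
    calc _ ≤ ∫⁻ s in Ioo 0 t, g s ^ p * I ^ (r / p - 1) := by
          refine setLIntegral_mono' measurableSet_Ioo fun s hs => ?_
          have hs0 : 0 < s := hs.1
          have h1 : g s ^ p * ENNReal.ofReal s ≤ I := by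
            calc g s ^ p * ENNReal.ofReal s = ∫⁻ _ in Ioo 0 s, g s ^ p := by
                  rw [setLIntegral_const, Real.volume_Ioo, sub_zero]
              _ ≤ ∫⁻ w in Ioo 0 s, g w ^ p :=
                  setLIntegral_mono' measurableSet_Ioo fun w hw => by
                    gcongr; exact hg hw.2.le
              _ ≤ I := lintegral_mono_set (Ioo_subset_Ioo_right hs.2.le)
          calc g s ^ r * ENNReal.ofReal (s ^ (r / p - 1))
              = g s ^ p * (g s ^ p * ENNReal.ofReal s) ^ (r / p - 1) := by
                rw [ENNReal.mul_rpow_of_nonneg _ _ hrp, ← ENNReal.rpow_mul, ← mul_assoc,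
                  ← ENNReal.rpow_add_of_nonneg _ _ hp.le (by positivity),
                  ENNReal.ofReal_rpow_of_pos hs0]
                congr 2; field_simp; ring
            _ ≤ _ := by gcongr
      _ = I * I ^ (r / p - 1) := by
          rw [lintegral_mul_const]
          exact (hg.measurable.pow_const p)
      _ = I ^ (r / p) := by
          nth_rw 1 [← ENNReal.rpow_one I]
          rw [← ENNReal.rpow_add_of_nonneg _ _ zero_le_one hrp]; congr 1; ring
  calc calderonH p r g t ≤ (ENNReal.ofReal (t ^ (-(r / p))) * I ^ (r / p)) ^ (1 / r) := by
        unfold calderonH; gcongr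
    _ = (((ENNReal.ofReal t)⁻¹ * I) ^ (r / p)) ^ (1 / r) := by
        rw [ENNReal.mul_rpow_of_nonneg _ I (show 0 ≤ r / p by positivity),
          ← ENNReal.ofReal_rpow_of_pos ht, ENNReal.rpow_neg, ENNReal.inv_rpow]
    _ = _ := by
        rw [← ENNReal.rpow_mul]; congr 1; field_simp

/-- For `t` in the level set, `t u^p < ∫₀ᵗ g^p`. Where `2g ≤ u`, one has `g^p ≤ u^p/2` because `2^p
≥ 2`, so that region contributes at most `t u^p/2` and can be subtracted. Thus `t ≤ 2J/u^p`: the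
level set lies in an interval of that length. -/
theorem lebPos_lt_calderonH_le {p r : ℝ} (hp : 1 ≤ p) (hpr : p ≤ r) {g : ℝ → ℝ≥0∞}
    (hg : Antitone g) {u : ℝ} (hu : 0 < u) :
    lebPos {t | ENNReal.ofReal u < calderonH p r g t} ≤ ENNReal.ofReal 2 *
      (ENNReal.ofReal (u ^ p))⁻¹ * ∫⁻ s, {s | ENNReal.ofReal u < 2 * g s}.indicator
        (fun s => (2 * g s) ^ p) s ∂lebPos := by
  have hp0 : 0 < p := by linarith
  set J := ∫⁻ s, {s | ENNReal.ofReal u < 2 * g s}.indicator (fun s => (2 * g s) ^ p) s ∂lebPos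
  have hup : 0 < u ^ p := Real.rpow_pos_of_pos hu p
  have hupE : ENNReal.ofReal (u ^ p) ≠ 0 := by simpa using hup
  rcases eq_or_ne J ∞ with hJ | hJ
  · rw [hJ, ENNReal.mul_top]
    · exact le_top
    · simp
  have hsub : ∀ t : ℝ, 0 < t → ENNReal.ofReal u < calderonH p r g t →
      ENNReal.ofReal t * ENNReal.ofReal (u ^ p) ≤ 2 * J := by
    intro t ht h
    have htE : ENNReal.ofReal t ≠ 0 := by simpa using ht
    have h1 := (h.trans_le (calderonH_le hp0 hpr hg ht))
    have h2 : ENNReal.ofReal (u ^ p) < (ENNReal.ofReal t)⁻¹ * ∫⁻ s in Ioo 0 t, g s ^ p := by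
      have := ENNReal.rpow_lt_rpow h1 hp0
      rwa [ENNReal.ofReal_rpow_of_pos hu, ← ENNReal.rpow_mul, one_div, inv_mul_cancel₀ hp0.ne',
        ENNReal.rpow_one] at this
    have h3 : ENNReal.ofReal t * ENNReal.ofReal (u ^ p) < ∫⁻ s in Ioo 0 t, g s ^ p := by
      have := ENNReal.mul_lt_mul_right htE ENNReal.ofReal_ne_top h2
      rwa [← mul_assoc, ENNReal.mul_inv_cancel htE ENNReal.ofReal_ne_top, one_mul] at this
    have h4 : ∫⁻ s in Ioo 0 t, g s ^ p ≤
        ENNReal.ofReal t * ENNReal.ofReal (u ^ p) / 2 + J := by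
      calc ∫⁻ s in Ioo 0 t, g s ^ p
          ≤ ∫⁻ s in Ioo 0 t, (ENNReal.ofReal (u ^ p) / 2 +
            {s | ENNReal.ofReal u < 2 * g s}.indicator (fun s => (2 * g s) ^ p) s) := by
            refine lintegral_mono fun s => ?_
            have h2p : (2 : ℝ≥0∞) ≤ 2 ^ p := by
              simpa using ENNReal.rpow_le_rpow_of_exponent_le (one_le_two : (1 : ℝ≥0∞) ≤ 2) hp
            have hle : 2 * g s ^ p ≤ (2 * g s) ^ p := by
              rw [ENNReal.mul_rpow_of_nonneg _ _ hp0.le]; gcongr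
            by_cases hs : ENNReal.ofReal u < 2 * g s
            · rw [indicator_of_mem (by exact hs)]
              refine le_trans (le_trans ?_ hle) le_add_self
              exact le_mul_of_one_le_left zero_le one_le_two
            · rw [indicator_of_notMem (by exact hs), add_zero,
                ENNReal.le_div_iff_mul_le (by simp) (by simp), mul_comm]
              refine hle.trans ?_
              rw [← ENNReal.ofReal_rpow_of_pos hu]
              exact ENNReal.rpow_le_rpow (not_lt.1 hs) hp0.le
        _ = ENNReal.ofReal t * ENNReal.ofReal (u ^ p) / 2 + ∫⁻ s in Ioo 0 t,
            {s | ENNReal.ofReal u < 2 * g s}.indicator (fun s => (2 * g s) ^ p) s := by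
            rw [lintegral_add_left measurable_const, setLIntegral_const, Real.volume_Ioo,
              sub_zero, mul_comm, mul_div_assoc]
        _ ≤ _ := by
            gcongr
            exact lintegral_mono' (Measure.restrict_mono (fun x hx => hx.1) le_rfl) le_rfl
    have h5 := h3.le.trans h4
    have hfin : ENNReal.ofReal t * ENNReal.ofReal (u ^ p) / 2 ≠ ∞ :=
      ENNReal.div_ne_top (by finiteness) (by simp)
    nth_rw 1 [← ENNReal.add_halves (ENNReal.ofReal t * ENNReal.ofReal (u ^ p))] at h5
    have h6 := (ENNReal.add_le_add_iff_left hfin).1 h5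
    rw [ENNReal.div_le_iff_le_mul (by simp) (by simp)] at h6
    rwa [mul_comm 2 J]
  set b : ℝ := (2 * J / ENNReal.ofReal (u ^ p)).toReal
  have hbfin : 2 * J / ENNReal.ofReal (u ^ p) ≠ ∞ :=
    ENNReal.div_ne_top (by finiteness) hupE
  calc lebPos {t | ENNReal.ofReal u < calderonH p r g t}
      ≤ volume (Icc 0 b) := by
        unfold lebPos
        rw [Measure.restrict_apply (measurableSet_lt measurable_const (calderonH_measurable p r g))]
        refine measure_mono fun t ht => ⟨le_of_lt ht.2, ?_⟩
        have := hsub t ht.2 ht.1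
        rw [← ENNReal.le_div_iff_mul_le (Or.inl hupE) (by simp)] at this
        exact (ENNReal.ofReal_le_iff_le_toReal hbfin).1 this
    _ = 2 * J / ENNReal.ofReal (u ^ p) := by
        rw [Real.volume_Icc, sub_zero, ENNReal.ofReal_toReal hbfin]
    _ = _ := by rw [div_eq_mul_inv, ENNReal.ofReal_ofNat]; ring

theorem rearr_antitone {Z : Type*} [MeasurableSpace Z] (μ : Measure Z) (f : Z → ℝ≥0∞) :
    Antitone (rearr μ f) := fun _ _ hst =>
  sInf_le_sInf fun _ hx => ⟨hx.1, hx.2.trans (ENNReal.ofReal_le_ofReal hst)⟩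

theorem DensityCondition.modularInequality {p r : ℝ} (hp : 1 ≤ p) (hpr : p ≤ r)
    {φ₁ φ₂ : ℝ → ℝ≥0∞} {Φ₁ Φ₂ : ℝ≥0∞ → ℝ≥0∞} (h₁ : IsMonotoneDensity φ₁ Φ₁)
    (h₂ : IsMonotoneDensity φ₂ Φ₂) (h : DensityCondition p φ₁ Φ₂) :
    ModularInequality p r Φ₁ Φ₂ := by
  obtain ⟨K, hK, hmod⟩ := h.lintegral_young_le (μ := lebPos) (ν := lebPos)
    (by linarith) h₁ h₂ two_pos
  refine ⟨K * 2, by positivity, fun f _ => ?_⟩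
  have hg := rearr_antitone lebPos f
  have := hmod (fun s => 2 * rearr lebPos f s) (calderonH p r (rearr lebPos f))
    (hg.measurable.const_mul 2) (calderonH_measurable p r _)
    (fun u hu => lebPos_lt_calderonH_le hp hpr hg hu)
  rw [ENNReal.ofReal_mul hK.le, ENNReal.ofReal_ofNat]
  simpa only [mul_assoc] using this

/-- Only `(a/2, a)` is kept in the integral: there `s^{r/p-1} ≥ (a/2)^{r/p-1}`, so the bound does
not depend on `r`. -/
theorem le_calderonH {p r : ℝ} (hp : 0 < p) (hpr : p ≤ r) {g : ℝ → ℝ≥0∞} {c : ℝ≥0∞} {a t : ℝ}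
    (hg : ∀ s, 0 < s → s < a → c ≤ g s) (ha : 0 < a) (hat : a ≤ t) :
    c * ENNReal.ofReal (a / (2 * t)) ^ (1 / p) ≤ calderonH p r g t := by
  have ht : 0 < t := ha.trans_le hat
  have hr : 0 < r := hp.trans_le hpr
  have hrp : 0 ≤ r / p - 1 := by rw [sub_nonneg, one_le_div hp]; exact hpr
  have key : c ^ r * ENNReal.ofReal ((a / 2) ^ (r / p))
      ≤ ∫⁻ s in Ioo 0 t, g s ^ r * ENNReal.ofReal (s ^ (r / p - 1)) := by
    calc c ^ r * ENNReal.ofReal ((a / 2) ^ (r / p))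
        = ∫⁻ _ in Ioo (a / 2) a, c ^ r * ENNReal.ofReal ((a / 2) ^ (r / p - 1)) := by
          rw [setLIntegral_const, Real.volume_Ioo, mul_assoc,
            ← ENNReal.ofReal_mul (by positivity)]
          congr 2
          rw [Real.rpow_sub_one (by positivity)]; field_simp; ring
      _ ≤ ∫⁻ s in Ioo (a / 2) a, g s ^ r * ENNReal.ofReal (s ^ (r / p - 1)) := by
          refine setLIntegral_mono' measurableSet_Ioo fun s hs => ?_
          gcongr
          · exact hg s (by linarith [hs.1]) hs.2
          · exact hs.1.le
      _ ≤ _ := lintegral_mono_set (Ioo_subset_Ioo (by positivity) hat)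
  calc c * ENNReal.ofReal (a / (2 * t)) ^ (1 / p)
      = (ENNReal.ofReal (t ^ (-(r / p))) * (c ^ r * ENNReal.ofReal ((a / 2) ^ (r / p)))) ^
        (1 / r) := by
        rw [mul_left_comm, ← ENNReal.ofReal_mul (by positivity),
          ENNReal.mul_rpow_of_nonneg _ _ (by positivity), ← ENNReal.rpow_mul,
          mul_one_div_cancel hr.ne', ENNReal.rpow_one, Real.rpow_neg ht.le,
          ← Real.inv_rpow ht.le, ← Real.mul_rpow (by positivity) (by positivity),
          ENNReal.ofReal_rpow_of_pos (by positivity), ENNReal.ofReal_rpow_of_pos (by positivity),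
          ← Real.rpow_mul (by positivity)]
        congr 3
        · field_simp
        · field_simp
    _ ≤ _ := by unfold calderonH; gcongr

theorem ModularInequality.densityCondition {p r : ℝ} (hp : 1 ≤ p) (hpr : p ≤ r)
    {φ₁ φ₂ : ℝ → ℝ≥0∞} {Φ₁ Φ₂ : ℝ≥0∞ → ℝ≥0∞} (h₁ : IsMonotoneDensity φ₁ Φ₁)
    (h₂ : IsMonotoneDensity φ₂ Φ₂) (h : ModularInequality p r Φ₁ Φ₂) :
    DensityCondition p φ₁ Φ₂ := by
  obtain ⟨K, hK, h⟩ := h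
  have hp0 : 0 < p := by linarith
  refine ⟨1, K * 2, one_pos, by positivity, fun b hb => ?_⟩
  -- Height `2b` rather than `b` pays for the factor `1/2` lost in `le_calderonH`, as `(1/2)^p ≤
  -- 1/2`.
  set f : ℝ → ℝ≥0∞ := (Ioo 0 1).indicator fun _ => ENNReal.ofReal (2 * b) with hf
  have hfm : Measurable f := measurable_const.indicator measurableSet_Ioo
  have hvol : lebPos (Ioo 0 1) = 1 := by
    unfold lebPos
    rw [Measure.restrict_apply measurableSet_Ioo, inter_eq_left.2 (fun x hx => hx.1)]
    simp
  have hlow : ∀ s, 0 < s → s < 1 → ENNReal.ofReal (2 * b) ≤ rearr lebPos f s := by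
    intro s _ hs1
    refine le_sInf fun v hv => ?_
    by_contra! hlt
    have : Ioo (0 : ℝ) 1 ⊆ {x | v < f x} := fun x hx => by
      rw [mem_ofPred_eq, hf, indicator_of_mem hx]; exact hlt
    have h1 := (measure_mono (μ := lebPos) this).trans hv.2
    rw [hvol, ENNReal.one_le_ofReal] at h1
    linarith
  have hup : ∀ s, rearr lebPos f s ≤ ENNReal.ofReal (2 * b) := by
    intro s
    refine sInf_le ⟨by simpa using hb, ?_⟩
    have : {x | ENNReal.ofReal (2 * b) < f x} = ∅ := by
      refine eq_empty_of_forall_notMem fun x hx => ?_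
      by_cases hx' : x ∈ Ioo (0 : ℝ) 1
      · rw [mem_ofPred_eq, hf, indicator_of_mem hx'] at hx
        exact lt_irrefl _ hx
      · rw [mem_ofPred_eq, hf, indicator_of_notMem hx'] at hx
        exact not_lt_zero hx
    rw [distFun, this]; simp
  have hzero : ∀ s, 1 ≤ s → rearr lebPos f s = 0 := by
    intro s hs
    refine le_zero_iff.1 (le_of_forall_gt fun v hv => ?_)
    obtain ⟨w, hw0, hwv⟩ := exists_between hv
    refine (sInf_le (show w ∈ {w | 0 < w ∧ distFun lebPos f w ≤ ENNReal.ofReal s} from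
      ⟨hw0, ?_⟩)).trans_lt hwv
    calc lebPos {x | w < f x} ≤ lebPos (Ioo 0 1) := by
          refine measure_mono fun x hx => ?_
          by_contra hx'
          rw [mem_ofPred_eq, hf, indicator_of_notMem hx'] at hx
          simp at hx
      _ ≤ _ := by rw [hvol]; simpa using hs
  have hR : ∫⁻ s, Φ₂ (ENNReal.ofReal K * rearr lebPos f s) ∂lebPos
      ≤ Φ₂ (ENNReal.ofReal (K * 2 * b)) := by
    calc _ ≤ ∫⁻ s, (Ioo (0 : ℝ) 1).indicator
          (fun _ => Φ₂ (ENNReal.ofReal (K * 2 * b))) s ∂lebPos := by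
          unfold lebPos
          refine setLIntegral_mono' measurableSet_Ioi fun s hs => ?_
          by_cases hs1 : s < 1
          · rw [indicator_of_mem (by exact ⟨hs, hs1⟩), mul_assoc, ENNReal.ofReal_mul hK.le]
            exact h₂.young_mono (mul_le_mul_right (hup s) _)
          · rw [show rearr (volume.restrict (Ioi 0)) f s = 0 from hzero s (not_lt.1 hs1),
              mul_zero, h₂.young_zero]
            exact zero_le
      _ = _ := by rw [lintegral_indicator_const measurableSet_Ioo, hvol, mul_one]
  have hL := h₁.mul_lintegral_density_le (ν := lebPos)
    (calderonH_measurable p r (rearr lebPos f)) (p := p) (b := b) 1 (fun u hu hub => by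
      rw [one_mul]
      calc ENNReal.ofReal ((b / u) ^ p) = lebPos (Ioo 0 ((b / u) ^ p)) := by
            unfold lebPos
            rw [Measure.restrict_apply measurableSet_Ioo, inter_eq_left.2 (fun x hx => hx.1)]
            simp
        _ ≤ _ := by
            -- Taking `a = min s 1` treats `s ≤ 1` and `s > 1` together. The claim becomes `(u/b)^p
            -- < min(s,1)/s`, true for `u < b` and `s < (b/u)^p`.
            refine measure_mono fun s hs => ?_
            have hs0 : 0 < s := hs.1
            have hmin : 0 < min s 1 := lt_min hs0 one_pos
            refine lt_of_lt_of_le ?_ (le_calderonH hp0 hpr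
              (fun w hw hw' => hlow w hw (hw'.trans_le (min_le_right s 1))) hmin (min_le_left s 1))
            rw [ENNReal.ofReal_rpow_of_pos (by positivity), ← ENNReal.ofReal_mul (by positivity),
              ENNReal.ofReal_lt_ofReal_iff (by positivity)]
            have hq : (u / b) ^ p < min s 1 / s := by
              have hub1 : (u / b) ^ p < 1 :=
                Real.rpow_lt_one (by positivity) ((div_lt_one hb).2 hub) hp0
              rw [lt_div_iff₀ hs0, lt_min_iff]
              refine ⟨by nlinarith, ?_⟩
              have h3 := hs.2
              have h4 : (u / b) ^ p * (b / u) ^ p = 1 := by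
                rw [← Real.mul_rpow (by positivity) (by positivity)]
                rw [show u / b * (b / u) = 1 by field_simp, Real.one_rpow]
              have h5 : 0 < (u / b) ^ p := by positivity
              nlinarith
            have h2p : ((1 : ℝ) / 2) ^ p ≤ 1 / 2 := by
              simpa using Real.rpow_le_rpow_of_exponent_ge (by norm_num : (0 : ℝ) < 1 / 2)
                (by norm_num) hp
            have hq2 : (u / (2 * b)) ^ p < min s 1 / (2 * s) := by
              calc (u / (2 * b)) ^ p = (1 / 2) ^ p * (u / b) ^ p := by
                    rw [← Real.mul_rpow (by positivity) (by positivity)]; congr 1; field_simp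
                _ ≤ 1 / 2 * (u / b) ^ p := by gcongr
                _ < 1 / 2 * (min s 1 / s) := by gcongr
                _ = _ := by field_simp
            have hq3 := Real.rpow_lt_rpow (by positivity) hq2 (by positivity : 0 < 1 / p)
            rw [← Real.rpow_mul (by positivity), mul_one_div_cancel hp0.ne', Real.rpow_one,
              div_lt_iff₀ (by positivity)] at hq3
            linarith)
  rw [one_mul] at hL
  rw [ENNReal.ofReal_one, one_mul]
  exact hL.trans ((h f hfm.aemeasurable).trans hR)

end Calderon

/-! ### Lorentz functionals versus `L_p` -/

section Lorentz

variable {Z 𝕜 : Type*} [MeasurableSpace Z] [RCLike 𝕜] {μ : Measure Z}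

theorem lorentzInt_mono {p r : ℝ} (hp : 0 < p) (hr : 0 < r) {f g : Z → 𝕜}
    (h : ∀ᵐ x ∂μ, ‖f x‖ₑ ≤ ‖g x‖ₑ) : lorentzInt p r μ f ≤ lorentzInt p r μ g := by
  have hd : ∀ s, distFun μ (fun x => ‖f x‖ₑ) s ≤ distFun μ (fun x => ‖g x‖ₑ) s := fun s => by
    refine measure_mono_ae ?_
    filter_upwards [h] with x hx hxt
    exact lt_of_lt_of_le hxt hx
  unfold lorentzInt
  gcongr
  exact hd _

/-- Same device as in `calderonH_le`: with `d` the distribution function, Chebyshev gives `d(t) t^p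
≤ J`, and `d^{r/p} t^{r-1} = (d t^{p-1}) (d t^p)^{r/p-1}`; the first factor integrates to `J/p ≤ J`.
-/
theorem lorentzInt_le {p r : ℝ} (hp : 1 ≤ p) (hpr : p ≤ r) {f : Z → 𝕜} (hf : Measurable f) :
    lorentzInt p r μ f ≤ (∫⁻ x, ‖f x‖ₑ ^ p ∂μ) ^ (1 / p) := by
  have hp0 : 0 < p := by linarith
  have hr : 0 < r := hp0.trans_le hpr
  have hrp : 0 ≤ r / p - 1 := by rw [sub_nonneg, one_le_div hp0]; exact hpr
  set J := ∫⁻ x, ‖f x‖ₑ ^ p ∂μ with hJ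
  have hcake : ∫⁻ t in Ioi (0 : ℝ), distFun μ (fun x => ‖f x‖ₑ) (ENNReal.ofReal t) *
      ENNReal.ofReal (t ^ (p - 1)) ≤ J := by
    have h := lintegral_rpow_eq_lintegral_meas_lt_mul μ (f := fun x => ‖f x‖)
      (ae_of_all _ fun x => norm_nonneg _) hf.norm.aemeasurable hp0
    have e1 : ∫⁻ x, ENNReal.ofReal (‖f x‖ ^ p) ∂μ = J := by
      refine lintegral_congr fun x => ?_
      rw [← ofReal_norm, ENNReal.ofReal_rpow_of_nonneg (norm_nonneg _) hp0.le]
    have e2 : ∫⁻ t in Ioi (0 : ℝ), μ {a | t < ‖f a‖} * ENNReal.ofReal (t ^ (p - 1))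
        = ∫⁻ t in Ioi (0 : ℝ), distFun μ (fun x => ‖f x‖ₑ) (ENNReal.ofReal t) *
          ENNReal.ofReal (t ^ (p - 1)) := by
      refine setLIntegral_congr_fun measurableSet_Ioi fun t ht => ?_
      have ht0 : 0 < t := ht
      simp only [distFun, ← ofReal_norm, ENNReal.ofReal_lt_ofReal_iff_of_nonneg ht0.le]
    rw [e1, e2] at h
    rw [h]
    exact le_mul_of_one_le_left zero_le (by simpa using hp)
  have hmarkov : ∀ t : ℝ, 0 < t →
      distFun μ (fun x => ‖f x‖ₑ) (ENNReal.ofReal t) * ENNReal.ofReal (t ^ p) ≤ J := by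
    intro t ht
    rw [mul_comm]
    refine le_trans ?_ (mul_meas_ge_le_lintegral (hf.enorm.pow_const p)
      (ENNReal.ofReal (t ^ p)))
    refine mul_le_mul_right (measure_mono fun x hx => ?_) _
    show ENNReal.ofReal (t ^ p) ≤ ‖f x‖ₑ ^ p
    rw [← ENNReal.ofReal_rpow_of_pos ht]
    exact ENNReal.rpow_le_rpow (le_of_lt hx) hp0.le
  have hmeas : Measurable fun t : ℝ => distFun μ (fun x => ‖f x‖ₑ) (ENNReal.ofReal t) *
      ENNReal.ofReal (t ^ (p - 1)) := by
    refine Measurable.mul (Antitone.measurable fun s t hst => ?_) (by fun_prop)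
    exact measure_mono fun x hx => lt_of_le_of_lt (ENNReal.ofReal_le_ofReal hst) hx
  have key : ∫⁻ t in Ioi (0 : ℝ), distFun μ (fun x => ‖f x‖ₑ) (ENNReal.ofReal t) ^ (r / p)
      * ENNReal.ofReal (t ^ (r - 1)) ≤ J ^ (r / p) := by
    calc _ ≤ ∫⁻ t in Ioi (0 : ℝ), (distFun μ (fun x => ‖f x‖ₑ) (ENNReal.ofReal t) *
          ENNReal.ofReal (t ^ (p - 1))) * J ^ (r / p - 1) := by
          refine setLIntegral_mono' measurableSet_Ioi fun t ht => ?_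
          have ht0 : 0 < t := ht
          set d := distFun μ (fun x => ‖f x‖ₑ) (ENNReal.ofReal t)
          calc d ^ (r / p) * ENNReal.ofReal (t ^ (r - 1))
              = (d * ENNReal.ofReal (t ^ (p - 1))) *
                (d * ENNReal.ofReal (t ^ p)) ^ (r / p - 1) := by
                rw [ENNReal.mul_rpow_of_nonneg _ _ hrp, ENNReal.ofReal_rpow_of_pos (by positivity),
                  ← Real.rpow_mul ht0.le, mul_mul_mul_comm, ← ENNReal.ofReal_mul (by positivity),
                  ← Real.rpow_add ht0]
                nth_rw 2 [← ENNReal.rpow_one d]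
                rw [← ENNReal.rpow_add_of_nonneg _ _ zero_le_one hrp]
                congr 3
                · ring
                · field_simp; ring
            _ ≤ _ := by gcongr; exact hmarkov t ht
      _ = (∫⁻ t in Ioi (0 : ℝ), distFun μ (fun x => ‖f x‖ₑ) (ENNReal.ofReal t) *
          ENNReal.ofReal (t ^ (p - 1))) * J ^ (r / p - 1) := lintegral_mul_const _ hmeas
      _ ≤ J * J ^ (r / p - 1) := by gcongr
      _ = J ^ (r / p) := by
          nth_rw 1 [← ENNReal.rpow_one J]
          rw [← ENNReal.rpow_add_of_nonneg _ _ zero_le_one hrp]; congr 1; ring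
  calc lorentzInt p r μ f ≤ (J ^ (r / p)) ^ (1 / r) := by
        unfold lorentzInt; gcongr
    _ = _ := by rw [← ENNReal.rpow_mul]; congr 1; field_simp

end Lorentz

/-! ### Cutting a function at a given height -/

section Truncation

variable {X 𝕜 : Type*} [MeasurableSpace X] [RCLike 𝕜] {μ : Measure X}

/-- Multiplication of a class of functions by the indicator of a measurable set. -/
noncomputable def restrictTo (S : Set X) (hS : MeasurableSet S) (f : X →ₘ[μ] 𝕜) : X →ₘ[μ] 𝕜 :=
  AEEqFun.mk (S.indicator f) (f.aestronglyMeasurable.indicator hS)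

theorem coeFn_restrictTo (S : Set X) (hS : MeasurableSet S) (f : X →ₘ[μ] 𝕜) :
    restrictTo S hS f =ᵐ[μ] S.indicator f := AEEqFun.coeFn_mk _ _

theorem restrictTo_add_restrictTo_compl (S : Set X) (hS : MeasurableSet S) (f : X →ₘ[μ] 𝕜) :
    restrictTo S hS f + restrictTo Sᶜ hS.compl f = f := by
  refine AEEqFun.ext ?_
  filter_upwards [AEEqFun.coeFn_add (restrictTo S hS f) (restrictTo Sᶜ hS.compl f),
    coeFn_restrictTo S hS f, coeFn_restrictTo Sᶜ hS.compl f] with x h1 h2 h3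
  rw [h1, Pi.add_apply, h2, h3, indicator_self_add_compl_apply]

theorem enorm_restrictTo_le (S : Set X) (hS : MeasurableSet S) (f : X →ₘ[μ] 𝕜) :
    ∀ᵐ x ∂μ, ‖restrictTo S hS f x‖ₑ ≤ ‖f x‖ₑ := by
  filter_upwards [coeFn_restrictTo S hS f] with x hx
  rw [hx]
  by_cases hxS : x ∈ S <;> simp [hxS]

theorem eLpNorm_top_le_of_ae {f : X → 𝕜} {c : ℝ≥0∞} (h : ∀ᵐ x ∂μ, ‖f x‖ₑ ≤ c) :
    eLpNorm f ∞ μ ≤ c := by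
  rw [eLpNorm_exponent_top, eLpNormEssSup_eq_essSup_enorm]
  exact essSup_le_of_ae_le c h

/-- A class of functions stable under multiplication by indicators of measurable sets. -/
def IndicatorStable (D : Set (X →ₘ[μ] 𝕜)) : Prop :=
  ∀ S (hS : MeasurableSet S), ∀ f ∈ D, restrictTo S hS f ∈ D

theorem indicatorStable_simpleFunctions : IndicatorStable (simpleFunctions 𝕜 μ) := by
  rintro S hS _ ⟨s, rfl⟩
  refine ⟨s.restrict S, AEEqFun.ext ?_⟩
  filter_upwards [AEEqFun.coeFn_mk (μ := μ) (s.restrict S) (s.restrict S).aestronglyMeasurable,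
    coeFn_restrictTo S hS (AEEqFun.mk s s.aestronglyMeasurable),
    AEEqFun.coeFn_mk (μ := μ) s s.aestronglyMeasurable] with x h1 h2 h3
  rw [h1, h2, SimpleFunc.coe_restrict _ hS]
  simp [indicator, h3]

theorem indicatorStable_lorentzSumLinfty {p r : ℝ} (hp : 0 < p) (hr : 0 < r) :
    IndicatorStable (lorentzSumLinfty 𝕜 p r μ) := by
  rintro S hS _ ⟨g, h, rfl, hg, hh⟩
  refine ⟨restrictTo S hS g, restrictTo S hS h, AEEqFun.ext ?_,
    (lorentzInt_mono hp hr (enorm_restrictTo_le S hS g)).trans_lt hg, ?_⟩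
  · filter_upwards [coeFn_restrictTo S hS (g + h), coeFn_restrictTo S hS g,
      coeFn_restrictTo S hS h, AEEqFun.coeFn_add g h,
      AEEqFun.coeFn_add (restrictTo S hS g) (restrictTo S hS h)] with x h1 h2 h3 h4 h5
    rw [h1, h5, Pi.add_apply, h2, h3]
    by_cases hx : x ∈ S <;> simp [hx, h4]
  · refine lt_of_le_of_lt (eLpNorm_mono_enorm_ae (enorm_restrictTo_le S hS h)) hh

theorem measurableSet_lt_enorm (f : X →ₘ[μ] 𝕜) (u : ℝ≥0∞) :
    MeasurableSet {x | u < ‖f x‖ₑ} :=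
  measurableSet_lt measurable_const f.measurable.enorm

theorem eLpNorm_restrictTo_compl_le (f : X →ₘ[μ] 𝕜) (u : ℝ≥0∞) :
    eLpNorm (restrictTo {x | u < ‖f x‖ₑ}ᶜ (measurableSet_lt_enorm f u).compl f) ∞ μ ≤ u := by
  refine eLpNorm_top_le_of_ae ?_
  filter_upwards [coeFn_restrictTo {x | u < ‖f x‖ₑ}ᶜ (measurableSet_lt_enorm f u).compl f]
    with x hx
  rw [hx]
  by_cases h : u < ‖f x‖ₑ
  · simp [indicator, h]
  · simpa [indicator, h] using not_lt.1 h

theorem lorentzInt_restrictTo_le {p r : ℝ} (hp : 1 ≤ p) (hpr : p ≤ r) (f : X →ₘ[μ] 𝕜)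
    (u : ℝ≥0∞) :
    lorentzInt p r μ (restrictTo {x | u < ‖f x‖ₑ} (measurableSet_lt_enorm f u) f)
      ≤ (∫⁻ x, {x | u < ‖f x‖ₑ}.indicator (fun x => ‖f x‖ₑ ^ p) x ∂μ) ^ (1 / p) := by
  refine (lorentzInt_le hp hpr (AEEqFun.measurable _)).trans_eq ?_
  congr 1
  refine lintegral_congr_ae ?_
  filter_upwards [coeFn_restrictTo {x | u < ‖f x‖ₑ} (measurableSet_lt_enorm f u) f] with x hx
  rw [hx]
  by_cases h : u < ‖f x‖ₑ
  · simp [indicator, h]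
  · simp [indicator, h, show 0 < p by linarith]

end Truncation

/-! ### Interpolation of operators of class `W` -/

section Interpolation

variable {X Y 𝕜 : Type*} [MeasurableSpace X] [MeasurableSpace Y] [RCLike 𝕜]
  {μ : Measure X} {ν : Measure Y}

theorem rearr_le {G : Y → ℝ≥0∞} {s : ℝ≥0∞} (hs : 0 < s) {t : ℝ}
    (h : ν {y | s < G y} ≤ ENNReal.ofReal t) : rearr ν G t ≤ s :=
  sInf_le ⟨hs, h⟩

theorem measure_lt_le_of_rearr_lt {G : Y → ℝ≥0∞} {s : ℝ≥0∞} {t : ℝ} (h : rearr ν G t < s) :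
    ν {y | s < G y} ≤ ENNReal.ofReal t := by
  obtain ⟨v, hv, hvs⟩ := sInf_lt_iff.1 h
  exact (measure_mono fun y hy => hvs.trans hy).trans hv.2

theorem MemW.distribution_le {D : Set (X →ₘ[μ] 𝕜)} (hD : IndicatorStable D) {p r : ℝ}
    (hp : 1 ≤ p) (hpr : p ≤ r) {T : (X →ₘ[μ] 𝕜) → (Y →ₘ[ν] 𝕜)} (hT : MemW D p r T) :
    ∃ K C : ℝ, 0 < K ∧ 0 < C ∧ ∀ f ∈ D, ∀ u : ℝ, 0 < u →
      ν {y | ENNReal.ofReal (K * u) < ‖T f y‖ₑ} ≤ ENNReal.ofReal C *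
        (ENNReal.ofReal (u ^ p))⁻¹ * ∫⁻ x, {x | ENNReal.ofReal u < ‖f x‖ₑ}.indicator
          (fun x => ‖f x‖ₑ ^ p) x ∂μ := by
  obtain ⟨C₁, c, hC₁, hc, -, hq⟩ := hT.quasilinear
  obtain ⟨C₂, hC₂, hw⟩ := hT.weak_type
  obtain ⟨M, hM, hb⟩ := hT.bounded
  have hp0 : 0 < p := by linarith
  -- The two pieces contribute `u` and `M u` inside the quasilinear bound, and `+ 1` makes the
  -- comparison strict, as `measure_lt_le_of_rearr_lt` needs. Division by `c` compensates for the
  -- dilation `t ↦ c t`.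
  refine ⟨C₁ * (1 + M) + 1, C₂ ^ p / c, by positivity, by positivity, fun f hf u hu => ?_⟩
  set S := {x | ENNReal.ofReal u < ‖f x‖ₑ} with hS
  have hSm : MeasurableSet S := measurableSet_lt_enorm f _
  set f₁ := restrictTo S hSm f
  set f₂ := restrictTo Sᶜ hSm.compl f
  have hf₁ : f₁ ∈ D := hD S hSm f hf
  have hf₂ : f₂ ∈ D := hD Sᶜ hSm.compl f hf
  have hadd : f₁ + f₂ = f := restrictTo_add_restrictTo_compl S hSm f
  set J := ∫⁻ x, S.indicator (fun x => ‖f x‖ₑ ^ p) x ∂μ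
  have huE : ENNReal.ofReal u ≠ 0 := by simpa using hu
  have hν₁ : ν {y | ENNReal.ofReal u < ‖T f₁ y‖ₑ}
      ≤ ENNReal.ofReal (C₂ ^ p) * (ENNReal.ofReal (u ^ p))⁻¹ * J := by
    have h1 := (hw f₁ hf₁ u hu).trans
      (mul_le_mul_right (lorentzInt_restrictTo_le hp hpr f (ENNReal.ofReal u)) _)
    have h2 := ENNReal.rpow_le_rpow h1 hp0.le
    rw [ENNReal.mul_rpow_of_nonneg _ _ hp0.le, ENNReal.mul_rpow_of_nonneg _ _ hp0.le,
      ← ENNReal.rpow_mul, ← ENNReal.rpow_mul, one_div_mul_cancel hp0.ne', ENNReal.rpow_one,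
      ENNReal.rpow_one, ENNReal.ofReal_rpow_of_pos hu, ENNReal.ofReal_rpow_of_pos hC₂,
      mul_comm (ENNReal.ofReal (u ^ p)), ← ENNReal.le_div_iff_mul_le
        (Or.inl (by simpa using Real.rpow_pos_of_pos hu p)) (by simp), div_eq_mul_inv] at h2
    calc _ ≤ _ := h2
      _ = _ := by ring
  -- The bound may be `0`, while quasilinearity is available only for `t > 0`; so each larger value
  -- `t` is used instead.
  refine le_of_forall_gt_imp_ge_of_dense fun b hb' => ?_
  rcases eq_or_ne b ∞ with rfl | hbtop
  · exact le_top
  obtain ⟨t, ht, rfl⟩ : ∃ t : ℝ, 0 < t ∧ b = ENNReal.ofReal t :=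
    ⟨b.toReal, ENNReal.toReal_pos (ne_bot_of_gt hb') hbtop, (ENNReal.ofReal_toReal hbtop).symm⟩
  have r1 : rearr ν (fun y => ‖T f₁ y‖ₑ) (c * t) ≤ ENNReal.ofReal u := by
    refine rearr_le (by simpa using hu) (hν₁.trans ?_)
    rw [ENNReal.ofReal_mul hc.le]
    refine le_trans (le_of_eq ?_) (mul_le_mul_right hb'.le _)
    rw [← mul_assoc, ← mul_assoc, ← ENNReal.ofReal_mul hc.le, mul_div_cancel₀ _ hc.ne']
  have r2 : rearr ν (fun y => ‖T f₂ y‖ₑ) (c * t) ≤ ENNReal.ofReal (M * u) := by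
    refine rearr_le (by simpa using mul_pos hM hu) (le_trans (le_of_eq ?_) zero_le)
    have h1 : eLpNorm (T f₂) ∞ ν ≤ ENNReal.ofReal (M * u) := by
      rw [ENNReal.ofReal_mul hM.le]
      exact (hb f₂ hf₂).trans (mul_le_mul_right (eLpNorm_restrictTo_compl_le f _) _)
    rw [eLpNorm_exponent_top] at h1
    have h2 : ∀ᵐ y ∂ν, ¬ ENNReal.ofReal (M * u) < ‖T f₂ y‖ₑ := by
      filter_upwards [enorm_ae_le_eLpNormEssSup (T f₂) ν] with y hy
      exact not_lt.2 (hy.trans h1)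
    simpa [ae_iff] using h2
  refine measure_lt_le_of_rearr_lt ?_
  calc rearr ν (fun y => ‖T f y‖ₑ) t ≤ ENNReal.ofReal C₁ * (_ + _) := by
        rw [← hadd]; exact hq f₁ hf₁ f₂ hf₂ t ht
    _ ≤ ENNReal.ofReal C₁ * (ENNReal.ofReal u + ENNReal.ofReal (M * u)) := by gcongr
    _ = ENNReal.ofReal (C₁ * (u + M * u)) := by
        rw [← ENNReal.ofReal_add hu.le (by positivity), ← ENNReal.ofReal_mul hC₁.le]
    _ < _ := by
        rw [ENNReal.ofReal_lt_ofReal_iff (by positivity)]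
        nlinarith

theorem gaugeNorm_le_of_forall {Φ₁ Φ₂ : ℝ≥0∞ → ℝ≥0∞} {f : X → 𝕜} {g : Y → 𝕜} {C : ℝ}
    (hC : 0 < C) (h : ∀ k : ℝ, 0 < k → ∫⁻ x, Φ₂ (‖f x‖ₑ / ENNReal.ofReal k) ∂μ ≤ 1 →
      ∫⁻ y, Φ₁ (‖g y‖ₑ / ENNReal.ofReal (C * k)) ∂ν ≤ 1) :
    gaugeNorm Φ₁ ν g ≤ ENNReal.ofReal C * gaugeNorm Φ₂ μ f := by
  have hCE : ENNReal.ofReal C ≠ 0 := by simpa using hC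
  rw [mul_comm, ← ENNReal.div_le_iff_le_mul (Or.inl hCE) (Or.inl ENNReal.ofReal_ne_top)]
  refine le_sInf fun k hk => ?_
  obtain ⟨hk0, hktop, hk⟩ := hk
  rw [ENNReal.div_le_iff_le_mul (Or.inl hCE) (Or.inl ENNReal.ofReal_ne_top), mul_comm]
  obtain ⟨a, ha, rfl⟩ : ∃ a : ℝ, 0 < a ∧ k = ENNReal.ofReal a :=
    ⟨k.toReal, ENNReal.toReal_pos hk0.ne' hktop.ne, (ENNReal.ofReal_toReal hktop.ne).symm⟩
  rw [← ENNReal.ofReal_mul hC.le]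
  exact sInf_le ⟨by simpa using mul_pos hC ha, ENNReal.ofReal_lt_top, h a ha hk⟩

theorem lt_div_ofReal_iff {a u : ℝ} (ha : 0 < a) (x : ℝ≥0∞) :
    ENNReal.ofReal u < x / ENNReal.ofReal a ↔ ENNReal.ofReal (u * a) < x := by
  rw [ENNReal.lt_div_iff_mul_lt (by simp [ha]) (by simp), ENNReal.ofReal_mul' ha.le]

theorem DensityCondition.boundedOn [SigmaFinite μ] [SigmaFinite ν] {D : Set (X →ₘ[μ] 𝕜)}
    (hD : IndicatorStable D) {p r : ℝ}
    (hp : 1 ≤ p) (hpr : p ≤ r) {φ₁ φ₂ : ℝ → ℝ≥0∞} {Φ₁ Φ₂ : ℝ≥0∞ → ℝ≥0∞}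
    (h₁ : IsMonotoneDensity φ₁ Φ₁) (h₂ : IsMonotoneDensity φ₂ Φ₂)
    (h : DensityCondition p φ₁ Φ₂) : BoundedOn D ν p r Φ₁ Φ₂ := by
  intro T hT
  have hp0 : 0 < p := by linarith
  obtain ⟨K, C, hK, hC, hdist⟩ := hT.distribution_le hD hp hpr
  obtain ⟨K₀, hK₀, hmod⟩ := h.lintegral_young_le (μ := μ) (ν := ν) hp0 h₁ h₂ hC
  -- Dividing `f` by the extra factor `K₀` in advance cancels the constant of the modular
  -- inequality. `T` need not be homogeneous: the distribution estimate is applied to `f` itself, at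
  -- the level `u K₀ k`.
  refine ⟨K * K₀, by positivity, fun f hf _ => gaugeNorm_le_of_forall (by positivity)
    fun k hk hle => le_trans ?_ hle⟩
  have ha : 0 < K₀ * k := by positivity
  have key := hmod (fun x => ‖f x‖ₑ / ENNReal.ofReal (K₀ * k))
    (fun y => ‖T f y‖ₑ / ENNReal.ofReal (K * K₀ * k)) (f.measurable.enorm.div_const _)
    ((T f).measurable.enorm.div_const _) (fun u hu => by
      simp_rw [lt_div_ofReal_iff ha, lt_div_ofReal_iff (show 0 < K * K₀ * k by positivity)]
      have := hdist f hf (u * (K₀ * k)) (by positivity)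
      rw [show K * (u * (K₀ * k)) = u * (K * K₀ * k) by ring] at this
      refine this.trans (le_of_eq ?_)
      have hapE : ENNReal.ofReal ((K₀ * k) ^ p) ≠ 0 := by
        simpa using Real.rpow_pos_of_pos ha p
      rw [Real.mul_rpow hu.le ha.le, ENNReal.ofReal_mul (by positivity),
        ENNReal.mul_inv (by simp) (by simp), mul_assoc, mul_assoc, mul_assoc,
        ← lintegral_const_mul' _ _ (ENNReal.inv_ne_top.2 hapE)]
      congr 2
      refine lintegral_congr fun x => ?_
      by_cases hx : ENNReal.ofReal (u * (K₀ * k)) < ‖f x‖ₑ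
      · simp only [indicator, mem_ofPred_eq, hx, if_true]
        rw [ENNReal.div_rpow_of_nonneg _ _ hp0.le, ENNReal.ofReal_rpow_of_pos ha, mul_comm,
          div_eq_mul_inv]
      · simp [indicator, hx])
  refine le_trans key (le_of_eq ?_)
  refine lintegral_congr fun x => ?_
  congr 1
  rw [ENNReal.ofReal_mul hK₀.le, ← mul_div_assoc,
    ENNReal.mul_div_mul_left _ _ (by simpa using hK₀) ENNReal.ofReal_ne_top]

/-- Once `t ≥ 2t₁`, the integral in the density condition stays above a fixed positive number, so
`Φ₂` grows at least like `t^p`. This puts the large part of an `L_{Φ₂}` function into `L_p`. -/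
theorem DensityCondition.rpow_le {p : ℝ} {φ₁ : ℝ → ℝ≥0∞} {Φ₁ Φ₂ : ℝ≥0∞ → ℝ≥0∞}
    (h₁ : IsMonotoneDensity φ₁ Φ₁) (hp : 0 < p) (h : DensityCondition p φ₁ Φ₂) :
    ∃ (B t₀ : ℝ) (c : ℝ≥0∞), 0 < B ∧ 0 < t₀ ∧ c ≠ ∞ ∧ ∀ t, t₀ ≤ t →
      ENNReal.ofReal (t ^ p) ≤ c * Φ₂ (ENNReal.ofReal (B * t)) := by
  obtain ⟨A, B, hA, hB, h⟩ := h
  obtain ⟨t₁, ht₁, hne⟩ := h₁.ne_zero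
  -- The minimum with `1` keeps `d` finite even if `φ₁ t₁ = ∞`.
  set d : ℝ≥0∞ := min (φ₁ t₁ / ENNReal.ofReal ((2 * t₁) ^ p) * ENNReal.ofReal t₁) 1
  have hd0 : d ≠ 0 := by
    refine (lt_min (pos_iff_ne_zero.2 (mul_ne_zero ?_ (by simpa using ht₁))) one_pos).ne'
    exact ENNReal.div_ne_zero.2 ⟨hne, ENNReal.ofReal_ne_top⟩
  have hdtop : d ≠ ∞ := ne_top_of_le_ne_top ENNReal.one_ne_top (min_le_right _ _)
  refine ⟨B, 2 * t₁, ENNReal.ofReal A / d, hB, by positivity,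
    ENNReal.div_ne_top ENNReal.ofReal_ne_top hd0, fun t ht => ?_⟩
  have hle : d ≤ ∫⁻ s in Ioo 0 t, φ₁ s / ENNReal.ofReal (s ^ p) := by
    calc d ≤ φ₁ t₁ / ENNReal.ofReal ((2 * t₁) ^ p) * ENNReal.ofReal t₁ := min_le_left _ _
      _ = ∫⁻ _ in Ioo t₁ (2 * t₁), φ₁ t₁ / ENNReal.ofReal ((2 * t₁) ^ p) := by
        rw [setLIntegral_const, Real.volume_Ioo]; congr 2; ring
      _ ≤ ∫⁻ s in Ioo t₁ (2 * t₁), φ₁ s / ENNReal.ofReal (s ^ p) := by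
        refine setLIntegral_mono' measurableSet_Ioo fun s hs => ?_
        have hs0 : 0 < s := ht₁.trans hs.1
        gcongr
        · exact h₁.mono hs.1.le
        · exact hs.2.le
      _ ≤ _ := lintegral_mono_set (Ioo_subset_Ioo ht₁.le ht)
  have h2 := (mul_le_mul_right hle (ENNReal.ofReal (t ^ p))).trans (h t (by linarith))
  rw [← ENNReal.le_div_iff_mul_le (Or.inl hd0) (Or.inl hdtop)] at h2
  refine h2.trans (le_of_eq ?_)
  rw [div_eq_mul_inv, div_eq_mul_inv]; ring

theorem DensityCondition.orliczClass_subset {p r : ℝ} (hp : 1 ≤ p) (hpr : p ≤ r)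
    {φ₁ : ℝ → ℝ≥0∞} {Φ₁ Φ₂ : ℝ≥0∞ → ℝ≥0∞} (h₁ : IsMonotoneDensity φ₁ Φ₁)
    (h : DensityCondition p φ₁ Φ₂) :
    orliczClass 𝕜 Φ₂ μ ⊆ lorentzSumLinfty 𝕜 p r μ := by
  rintro f ⟨k, hk, hint⟩
  have hp0 : 0 < p := by linarith
  obtain ⟨B, t₀, c, hB, ht₀, hc, h⟩ := h.rpow_le h₁ hp0
  -- Chosen so that `|f| > u` means `k|f|/B > t₀`, where `rpow_le` bounds `|f|^p` by a multiple of
  -- `Φ₂(k|f|)`.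
  set u : ℝ := t₀ * B / k with hu
  set S := {x | ENNReal.ofReal u < ‖f x‖ₑ} with hS
  have hSm : MeasurableSet S := measurableSet_lt_enorm f _
  refine ⟨restrictTo S hSm f, restrictTo Sᶜ hSm.compl f,
    (restrictTo_add_restrictTo_compl S hSm f).symm, ?_,
    (eLpNorm_restrictTo_compl_le f _).trans_lt ENNReal.ofReal_lt_top⟩
  refine (lorentzInt_restrictTo_le hp hpr f _).trans_lt
    (ENNReal.rpow_lt_top_of_nonneg (by positivity) (ne_of_lt ?_))
  set a : ℝ := (B / k) ^ p
  calc ∫⁻ x, S.indicator (fun x => ‖f x‖ₑ ^ p) x ∂μ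
      ≤ ∫⁻ x, (ENNReal.ofReal a * c) * Φ₂ (ENNReal.ofReal k * ‖f x‖ₑ) ∂μ := by
        refine lintegral_mono fun x => ?_
        by_cases hx : x ∈ S
        · rw [indicator_of_mem hx]
          have hx' : ENNReal.ofReal u < ‖f x‖ₑ := hx
          rw [← ofReal_norm, ENNReal.ofReal_lt_ofReal_iff_of_nonneg (by positivity)] at hx'
          have ht : t₀ ≤ k * ‖f x‖ / B := by
            rw [le_div_iff₀ hB]; rw [hu, div_lt_iff₀ hk] at hx'; linarith
          have h3 := mul_le_mul_right (h _ ht) (ENNReal.ofReal a)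
          rw [← ENNReal.ofReal_mul (by positivity), ← Real.mul_rpow (by positivity)
            (by positivity), mul_div_cancel₀ _ hB.ne', ENNReal.ofReal_mul hk.le, ofReal_norm,
            ← mul_assoc, show B / k * (k * ‖f x‖ / B) = ‖f x‖ by field_simp,
            ← ENNReal.ofReal_rpow_of_nonneg (norm_nonneg _) hp0.le, ofReal_norm] at h3
          exact h3
        · rw [indicator_of_notMem hx]; exact zero_le
    _ = (ENNReal.ofReal a * c) * ∫⁻ x, Φ₂ (ENNReal.ofReal k * ‖f x‖ₑ) ∂μ :=
        lintegral_const_mul' _ _ (ENNReal.mul_ne_top ENNReal.ofReal_ne_top hc)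
    _ < ∞ := ENNReal.mul_lt_top (ENNReal.mul_lt_top ENNReal.ofReal_lt_top hc.lt_top) hint

end Interpolation

/-! ### Nonatomic measures and a uniformly distributed function -/

section Nonatomic

variable {Z : Type*} [MeasurableSpace Z] {μ : Measure Z}

theorem IsNonatomic.exists_subset_le_half (h : IsNonatomic μ) {A : Set Z} (hA : MeasurableSet A)
    (h0 : 0 < μ A) (htop : μ A < ∞) :
    ∃ B ⊆ A, MeasurableSet B ∧ 0 < μ B ∧ μ B ≤ μ A / 2 := by
  obtain ⟨B, hBA, hB, hB0, hlt⟩ := h A hA h0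
  by_cases hle : μ B ≤ μ A / 2
  · exact ⟨B, hBA, hB, hB0, hle⟩
  · have hdiff : μ (A \ B) = μ A - μ B :=
      measure_sdiff hBA hB.nullMeasurableSet (hlt.trans htop).ne
    refine ⟨A \ B, sdiff_subset, hA.diff hB, ?_, ?_⟩
    · rw [hdiff]; exact tsub_pos_of_lt hlt
    · rw [hdiff, tsub_le_iff_right]
      calc μ A = μ A / 2 + μ A / 2 := (ENNReal.add_halves _).symm
        _ ≤ _ := by gcongr; exact (not_le.1 hle).le

theorem IsNonatomic.exists_subset_le (h : IsNonatomic μ) {A : Set Z} (hA : MeasurableSet A)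
    (h0 : 0 < μ A) (htop : μ A < ∞) {ε : ℝ≥0∞} (hε : 0 < ε) :
    ∃ B ⊆ A, MeasurableSet B ∧ 0 < μ B ∧ μ B ≤ ε := by
  have hn : ∀ n : ℕ, ∃ B ⊆ A, MeasurableSet B ∧ 0 < μ B ∧ μ B ≤ μ A * 2⁻¹ ^ n := by
    intro n
    induction n with
    | zero => exact ⟨A, Subset.rfl, hA, h0, by simp⟩
    | succ n ih =>
      obtain ⟨B, hBA, hB, hB0, hle⟩ := ih
      obtain ⟨B', hB'B, hB', hB'0, hle'⟩ :=
        h.exists_subset_le_half hB hB0 ((measure_mono hBA).trans_lt htop)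
      refine ⟨B', hB'B.trans hBA, hB', hB'0, hle'.trans ?_⟩
      rw [pow_succ, ← mul_assoc, div_eq_mul_inv]
      gcongr
  have hlim : Tendsto (fun n : ℕ => μ A * 2⁻¹ ^ n) atTop (𝓝 0) := by
    simpa using ENNReal.Tendsto.const_mul
      (ENNReal.tendsto_pow_atTop_nhds_zero_of_lt_one (r := 2⁻¹) (by simp))
      (Or.inr htop.ne)
  obtain ⟨n, hlt⟩ := (hlim.eventually (gt_mem_nhds hε)).exists
  obtain ⟨B, hBA, hB, hB0, hle⟩ := hn n
  exact ⟨B, hBA, hB, hB0, hle.trans hlt.le⟩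

/-- If no measure falls in `[m, 2m]`, then sets of measure at most `2m` have measure below `m`, so
they are closed under finite and then countable unions. Hence one of them, `U`, has maximal measure;
adjoining a small set of positive measure from its complement contradicts maximality. -/
theorem IsNonatomic.exists_measure_mem_Icc [SigmaFinite μ] (h : IsNonatomic μ)
    (hμ : μ univ = ∞) {m : ℝ≥0∞} (hm : 0 < m) (hmtop : m ≠ ∞) :
    ∃ B, MeasurableSet B ∧ m ≤ μ B ∧ μ B ≤ 2 * m := by
  by_contra! hcon
  have hlt : ∀ B, MeasurableSet B → μ B ≤ 2 * m → μ B < m := fun B hB hB2 => by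
    by_contra! hle
    exact absurd hB2 (not_le.2 (hcon B hB hle))
  set 𝒮 : Set (Set Z) := {B | MeasurableSet B ∧ μ B ≤ 2 * m}
  obtain ⟨u, -, hu, hu𝒮⟩ := exists_seq_tendsto_sSup
    (show (μ '' 𝒮).Nonempty from ⟨μ ∅, ∅, by simp [𝒮], rfl⟩) (OrderTop.bddAbove _)
  choose B hB hBu using hu𝒮
  have hacc : ∀ n, MeasurableSet (accumulate B n) ∧ μ (accumulate B n) ≤ 2 * m := by
    intro n
    induction n with
    | zero => simpa [𝒮] using hB 0
    | succ n ih =>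
      rw [accumulate_succ]
      refine ⟨ih.1.union (hB _).1, (measure_union_le _ _).trans ?_⟩
      rw [two_mul]
      exact add_le_add (hlt _ ih.1 ih.2).le (hlt _ (hB _).1 (hB _).2).le
  set U := ⋃ n, B n
  have hUm : MeasurableSet U := MeasurableSet.iUnion fun n => (hB n).1
  have hU2 : μ U ≤ 2 * m := by
    rw [measure_iUnion_eq_iSup_accumulate]
    exact iSup_le fun n => (hacc n).2
  have hUlt : μ U < m := hlt U hUm hU2
  have hmax : ∀ V, MeasurableSet V → μ V ≤ 2 * m → μ V ≤ μ U := fun V hV hV2 => by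
    refine (le_sSup (show μ V ∈ μ '' 𝒮 from ⟨V, ⟨hV, hV2⟩, rfl⟩)).trans ?_
    refine le_of_tendsto' hu fun n => ?_
    rw [← hBu]
    exact measure_mono (subset_iUnion B n)
  have hUc : μ Uᶜ = ∞ := by
    by_contra hne
    have := measure_add_measure_compl (μ := μ) hUm
    rw [hμ] at this
    exact (ENNReal.add_ne_top.2 ⟨(hUlt.trans hmtop.lt_top).ne, hne⟩) this
  obtain ⟨A, hAm, hAU, hA0, hAtop⟩ :=
    Measure.exists_subset_measure_lt_top hUm.compl (r := 0) (by rw [hUc]; exact ENNReal.zero_lt_top)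
  obtain ⟨V, hVA, hVm, hV0, hVle⟩ := h.exists_subset_le hAm hA0 hAtop hm
  have hdisj : Disjoint U V :=
    disjoint_left.2 fun x hx hxV => hAU (hVA hxV) hx
  have hUV : μ (U ∪ V) = μ U + μ V := measure_union hdisj hVm
  have := hmax (U ∪ V) (hUm.union hVm) (by rw [hUV, two_mul]; exact add_le_add hUlt.le hVle)
  rw [hUV] at this
  exact absurd this (not_le.2 (ENNReal.lt_add_right (hUlt.trans hmtop.lt_top).ne hV0.ne'))

/-- A function whose distribution is comparable to Lebesgue measure on `(0,∞)`. -/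
structure IsUniformlyDistributed (μ : Measure Z) (τ : Z → ℝ≥0∞) : Prop where
  measurable : Measurable τ
  lower : ∀ s : ℝ, 0 < s → ENNReal.ofReal (s / 2) ≤ μ {y | τ y < ENNReal.ofReal s}
  upper : ∀ s : ℝ, 0 < s → μ {y | τ y < ENNReal.ofReal s} ≤ ENNReal.ofReal (4 * s)

/-- Choose sets `A k` of measure between `2^k` and `2^(k+1)`, with no nesting required, and let `τ`
be the infimum of `2^k` over those containing the point. Then `{τ < s}` is the union of the `A k`
with `2^k < s`: its largest member gives the lower bound, a geometric series the upper one. -/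
theorem IsNonatomic.exists_isUniformlyDistributed [SigmaFinite μ] (h : IsNonatomic μ)
    (hμ : μ univ = ∞) : ∃ τ, IsUniformlyDistributed μ τ := by
  have h2 : ∀ k : ℤ, 0 < (2 : ℝ) ^ k := fun k => by positivity
  choose A hA hlow hup using fun k : ℤ => h.exists_measure_mem_Icc hμ
    (m := ENNReal.ofReal (2 ^ k)) (by simpa using h2 k) ENNReal.ofReal_ne_top
  classical
  set τ : Z → ℝ≥0∞ := fun y => ⨅ k : ℤ, (A k)ᶜ.indicator (fun _ => ∞) y + ENNReal.ofReal (2 ^ k)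
  have hτ : ∀ y s, τ y < ENNReal.ofReal s ↔ ∃ k : ℤ, y ∈ A k ∧ (2 : ℝ) ^ k < s := by
    intro y s
    rw [iInf_lt_iff]
    refine exists_congr fun k => ?_
    by_cases hy : y ∈ A k
    · simp [hy, ENNReal.ofReal_lt_ofReal_iff']
      exact fun hs => (h2 k).trans hs
    · simp [hy]
  refine ⟨τ, Measurable.iInf fun k => (measurable_const.indicator (hA k).compl).add_const _,
    fun s hs => ?_, fun s hs => ?_⟩
  · obtain ⟨k, hk1, hk2⟩ := exists_mem_Ioc_zpow hs one_lt_two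
    refine le_trans ?_ ((hlow k).trans (measure_mono fun y hy => (hτ y s).2 ⟨k, hy, hk1⟩))
    refine ENNReal.ofReal_le_ofReal ?_
    rw [zpow_add_one₀ two_ne_zero] at hk2
    linarith
  · obtain ⟨k, hk1, hk2⟩ := exists_mem_Ioc_zpow hs one_lt_two
    have hsub : {y | τ y < ENNReal.ofReal s} ⊆ ⋃ n : ℕ, A (k - n) := by
      intro y hy
      obtain ⟨j, hyj, hj⟩ := (hτ y s).1 hy
      have hjk : j < k + 1 := (zpow_lt_zpow_iff_right₀ one_lt_two).1 (hj.trans_le hk2)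
      refine mem_iUnion.2 ⟨(k - j).toNat, ?_⟩
      rwa [Int.toNat_of_nonneg (by omega), sub_sub_cancel]
    calc μ {y | τ y < ENNReal.ofReal s} ≤ μ (⋃ n : ℕ, A (k - n)) := measure_mono hsub
      _ ≤ ∑' n : ℕ, μ (A (k - n)) := measure_iUnion_le _
      _ ≤ ∑' n : ℕ, 2 * ENNReal.ofReal (2 ^ k) * 2⁻¹ ^ n := by
          refine ENNReal.tsum_le_tsum fun n => (hup _).trans (le_of_eq ?_)
          rw [zpow_sub₀ two_ne_zero, div_eq_mul_inv, ENNReal.ofReal_mul (h2 k).le, ← mul_assoc,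
            zpow_natCast, ← inv_pow, ENNReal.ofReal_pow (by norm_num),
            ENNReal.ofReal_inv_of_pos two_pos, ENNReal.ofReal_ofNat]
      _ = ENNReal.ofReal (4 * 2 ^ k) := by
          rw [ENNReal.tsum_mul_left, ENNReal.tsum_geometric, ENNReal.one_sub_inv_two, inv_inv,
            ENNReal.ofReal_mul (by norm_num), ENNReal.ofReal_ofNat]
          ring
      _ ≤ _ := ENNReal.ofReal_le_ofReal (by linarith)

theorem IsUniformlyDistributed.measure_le {τ : Z → ℝ≥0∞} (h : IsUniformlyDistributed μ τ)
    (x : ℝ≥0∞) : μ {y | τ y ≤ x} ≤ 4 * x := by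
  refine le_of_forall_gt_imp_ge_of_dense fun b hb => ?_
  rcases eq_or_ne b ∞ with rfl | hbtop
  · exact le_top
  have hx : x < b / 4 := by
    rw [ENNReal.lt_div_iff_mul_lt (by simp) (by simp), mul_comm]; exact hb
  obtain ⟨s, hs, hsb⟩ : ∃ s : ℝ, 0 < s ∧ b = ENNReal.ofReal (4 * s) :=
    ⟨b.toReal / 4, div_pos (ENNReal.toReal_pos (ne_bot_of_gt hb) hbtop) (by norm_num), by
      rw [mul_div_cancel₀ _ four_ne_zero, ENNReal.ofReal_toReal hbtop]⟩
  have hb4 : b / 4 = ENNReal.ofReal s := by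
    rw [hsb, ENNReal.ofReal_mul (by norm_num), ENNReal.ofReal_ofNat, mul_comm,
      ENNReal.mul_div_cancel_right (by simp) (by simp)]
  rw [hb4] at hx
  rw [hsb]
  exact (measure_mono fun y hy => lt_of_le_of_lt hy hx).trans (h.upper s hs)

theorem IsUniformlyDistributed.ae_ne_zero {τ : Z → ℝ≥0∞} (h : IsUniformlyDistributed μ τ) :
    ∀ᵐ y ∂μ, τ y ≠ 0 := by
  have := h.measure_le 0
  simpa [ae_iff] using this

end Nonatomic

/-! ### The extremal majorant of the rearrangement -/

section WeakMaximal

variable {Z : Type*} [MeasurableSpace Z] {μ : Measure Z}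

/-- `t ↦ sup_l l · min(1, (μ {f > l} / t)^{1/p})`, a decreasing majorant of `f*` of weak
type `(p,p)` and bounded on `L_∞`. -/
noncomputable def weakMaximal (p : ℝ) (μ : Measure Z) (f : Z → ℝ≥0∞) (t : ℝ≥0∞) : ℝ≥0∞ :=
  ⨆ l : ℝ≥0∞, l * min 1 ((distFun μ f l / t) ^ (1 / p))

theorem weakMaximal_antitone {p : ℝ} (hp : 0 < p) (f : Z → ℝ≥0∞) :
    Antitone (weakMaximal p μ f) := by
  intro s t hst
  unfold weakMaximal
  gcongr

/-- `{f > l}` is covered by `{g > l/2}` and `{h > l/2}`, so its measure is at most twice the larger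
one; doubling a measure amounts to halving `t`. -/
theorem weakMaximal_le_two_mul {p : ℝ} (hp : 0 < p) {f g h : Z → ℝ≥0∞}
    (hfgh : ∀ᵐ x ∂μ, f x ≤ g x + h x) (t : ℝ≥0∞) :
    weakMaximal p μ f t ≤ 2 * (weakMaximal p μ g (t / 2) + weakMaximal p μ h (t / 2)) := by
  refine iSup_le fun l => ?_
  have hd : distFun μ f l ≤ distFun μ g (l / 2) + distFun μ h (l / 2) := by
    refine le_trans (measure_mono_ae ?_) (measure_union_le _ _)
    filter_upwards [hfgh] with x hx hl
    by_contra hcon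
    rw [show ({x | l / 2 < g x} ∪ {x | l / 2 < h x} : Set Z) x ↔ l / 2 < g x ∨ l / 2 < h x
      from Iff.rfl, not_or, not_lt, not_lt] at hcon
    have := hx.trans (add_le_add hcon.1 hcon.2)
    rw [ENNReal.add_halves] at this
    exact absurd hl (not_lt.2 this)
  have hhalf : ∀ d : ℝ≥0∞, 2 * d / t = d / (t / 2) := fun d => by
    rw [div_eq_mul_inv, div_eq_mul_inv, div_eq_mul_inv t, ENNReal.mul_inv (by simp) (by simp),
      inv_inv]
    ring
  have step : ∀ d : ℝ≥0∞, distFun μ f l ≤ 2 * d →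
      l * min 1 ((distFun μ f l / t) ^ (1 / p))
        ≤ 2 * (l / 2 * min 1 ((d / (t / 2)) ^ (1 / p))) := fun d hdle => by
    rw [← mul_assoc, ENNReal.mul_div_cancel (by simp) (by simp), ← hhalf]
    gcongr
  rcases le_total (distFun μ g (l / 2)) (distFun μ h (l / 2)) with hle | hle
  · refine (step (distFun μ h (l / 2)) (by rw [two_mul]; exact hd.trans (by gcongr))).trans ?_
    gcongr
    exact (le_iSup (fun l => l * min 1 ((distFun μ h l / (t / 2)) ^ (1 / p))) (l / 2)).trans
      le_add_self
  · refine (step (distFun μ g (l / 2)) (by rw [two_mul]; exact hd.trans (by gcongr))).trans ?_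
    gcongr
    exact (le_iSup (fun l => l * min 1 ((distFun μ g l / (t / 2)) ^ (1 / p))) (l / 2)).trans
      le_self_add

theorem weakMaximal_le_of_ae_le {p : ℝ} (hp : 0 < p) {f : Z → ℝ≥0∞} {c : ℝ≥0∞}
    (h : ∀ᵐ x ∂μ, f x ≤ c) (t : ℝ≥0∞) : weakMaximal p μ f t ≤ c := by
  refine iSup_le fun l => ?_
  rcases le_or_gt l c with hl | hl
  · exact (mul_le_of_le_one_right zero_le (min_le_left _ _)).trans hl
  · have : distFun μ f l = 0 := by
      refine measure_mono_null (t := {x | ¬ f x ≤ c}) (fun x hx => ?_) (ae_iff.1 h)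
      exact not_le.2 (hl.trans hx)
    rw [this, ENNReal.zero_div, ENNReal.zero_rpow_of_pos (by positivity)]
    simp

/-- The embedding of `L_{p,r}` in weak `L_p`: integrate over `(a/2, a)`, where the distribution
function is at least its value at `a`. -/
theorem mul_distFun_rpow_le_lorentzInt {𝕜 : Type*} [RCLike 𝕜] {p r : ℝ} (hp : 0 < p) (hr : 1 ≤ r)
    (f : Z → 𝕜) (l : ℝ≥0∞) :
    l * distFun μ (fun x => ‖f x‖ₑ) l ^ (1 / p) ≤ 2 * lorentzInt p r μ f := by
  have hr0 : 0 < r := by linarith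
  rcases eq_or_ne l ∞ with rfl | hl
  · simp [distFun, hp]
  obtain ⟨a, ha, rfl⟩ : ∃ a : ℝ, 0 ≤ a ∧ l = ENNReal.ofReal a :=
    ⟨l.toReal, ENNReal.toReal_nonneg, (ENNReal.ofReal_toReal hl).symm⟩
  rcases ha.eq_or_lt with rfl | ha
  · simp
  set d := distFun μ (fun x => ‖f x‖ₑ) (ENNReal.ofReal a) with hd
  have key : d ^ (r / p) * ENNReal.ofReal ((a / 2) ^ r) ≤
      ∫⁻ t in Ioi (0 : ℝ), distFun μ (fun x => ‖f x‖ₑ) (ENNReal.ofReal t) ^ (r / p)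
        * ENNReal.ofReal (t ^ (r - 1)) := by
    calc d ^ (r / p) * ENNReal.ofReal ((a / 2) ^ r)
        = ∫⁻ _ in Ioo (a / 2) a, d ^ (r / p) * ENNReal.ofReal ((a / 2) ^ (r - 1)) := by
          rw [setLIntegral_const, Real.volume_Ioo, mul_assoc,
            ← ENNReal.ofReal_mul (by positivity)]
          congr 2
          rw [Real.rpow_sub_one (by positivity)]; field_simp; ring
      _ ≤ ∫⁻ t in Ioo (a / 2) a, distFun μ (fun x => ‖f x‖ₑ) (ENNReal.ofReal t) ^ (r / p)
            * ENNReal.ofReal (t ^ (r - 1)) := by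
          refine setLIntegral_mono' measurableSet_Ioo fun t ht => ?_
          have h1 : d ≤ distFun μ (fun x => ‖f x‖ₑ) (ENNReal.ofReal t) :=
            measure_mono fun x hx => lt_of_le_of_lt (ENNReal.ofReal_le_ofReal ht.2.le) hx
          have h2 : (a / 2) ^ (r - 1) ≤ t ^ (r - 1) :=
            Real.rpow_le_rpow (by positivity) ht.1.le (by linarith)
          gcongr
      _ ≤ _ := lintegral_mono_set fun x hx => lt_trans (by positivity : 0 < a / 2) hx.1
  have h2 : d ^ (1 / p) * ENNReal.ofReal (a / 2) ≤ lorentzInt p r μ f := by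
    calc d ^ (1 / p) * ENNReal.ofReal (a / 2)
        = (d ^ (r / p) * ENNReal.ofReal ((a / 2) ^ r)) ^ (1 / r) := by
          rw [ENNReal.mul_rpow_of_nonneg _ _ (by positivity),
            ← ENNReal.ofReal_rpow_of_pos (by positivity), ← ENNReal.rpow_mul, ← ENNReal.rpow_mul,
            mul_one_div_cancel hr0.ne', ENNReal.rpow_one]
          congr 2; field_simp
      _ ≤ _ := by unfold lorentzInt; gcongr
  calc ENNReal.ofReal a * d ^ (1 / p) = 2 * (d ^ (1 / p) * ENNReal.ofReal (a / 2)) := by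
        rw [ENNReal.ofReal_div_of_pos two_pos, ENNReal.ofReal_ofNat, mul_left_comm,
          ENNReal.mul_div_cancel (by simp) (by simp), mul_comm]
    _ ≤ _ := by gcongr

theorem weakMaximal_le_lorentzInt {𝕜 : Type*} [RCLike 𝕜] {p r : ℝ} (hp : 0 < p) (hr : 1 ≤ r)
    (f : Z → 𝕜) (t : ℝ≥0∞) :
    weakMaximal p μ (fun x => ‖f x‖ₑ) t ≤ 2 * lorentzInt p r μ f * t⁻¹ ^ (1 / p) := by
  refine iSup_le fun l => ?_
  calc _ ≤ l * (distFun μ (fun x => ‖f x‖ₑ) l / t) ^ (1 / p) := by gcongr; exact min_le_right _ _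
    _ = l * distFun μ (fun x => ‖f x‖ₑ) l ^ (1 / p) * t⁻¹ ^ (1 / p) := by
      rw [div_eq_mul_inv, ENNReal.mul_rpow_of_nonneg _ _ (by positivity), mul_assoc]
    _ ≤ _ := mul_le_mul_left (mul_distFun_rpow_le_lorentzInt hp hr f l) _

theorem measure_lt_weakMaximal_le {𝕜 Y : Type*} [RCLike 𝕜] [MeasurableSpace Y] {ν : Measure Y}
    {τ : Y → ℝ≥0∞} (hτ : IsUniformlyDistributed ν τ) {p r : ℝ} (hp : 0 < p) (hr : 1 ≤ r)
    (f : Z → 𝕜) {l : ℝ} (hl : 0 < l) :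
    ν {y | ENNReal.ofReal l < weakMaximal p μ (fun x => ‖f x‖ₑ) (τ y)}
      ≤ 4 * ((2 * lorentzInt p r μ f) ^ p / ENNReal.ofReal l ^ p) := by
  refine (measure_mono fun y hy => ?_).trans (hτ.measure_le _)
  have hlp : ENNReal.ofReal l ^ p ≠ 0 := by
    rw [ENNReal.ofReal_rpow_of_pos hl]
    simpa using Real.rpow_pos_of_pos hl p
  have h1 := ENNReal.rpow_le_rpow
    ((show _ < _ from hy).le.trans (weakMaximal_le_lorentzInt hp hr f (τ y))) hp.le
  rw [ENNReal.mul_rpow_of_nonneg _ _ hp.le, ← ENNReal.rpow_mul, one_div_mul_cancel hp.ne',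
    ENNReal.rpow_one, ← div_eq_mul_inv] at h1
  have h2 := ENNReal.mul_le_of_le_div h1
  show τ y ≤ _
  rw [ENNReal.le_div_iff_mul_le (Or.inl hlp) (Or.inl (by finiteness)), mul_comm]
  exact h2

/-- The single level `l = v` in the supremum suffices. -/
theorem lt_weakMaximal {p : ℝ} (hp : 0 < p) {f : Z → ℝ≥0∞} {u v m : ℝ} (hu : 0 < u) (huv : u < v)
    (hd : ENNReal.ofReal m ≤ distFun μ f (ENNReal.ofReal v)) {t : ℝ≥0∞}
    (ht0 : t ≠ 0) (ht : t < ENNReal.ofReal (m * (v / u) ^ p)) :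
    ENNReal.ofReal u < weakMaximal p μ f t := by
  have hv : 0 < v := hu.trans huv
  refine lt_of_lt_of_le ?_ (le_iSup (fun l => l * min 1 ((distFun μ f l / t) ^ (1 / p)))
    (ENNReal.ofReal v))
  rw [mul_comm, ← ENNReal.div_lt_iff (by simp [hv]) (by simp), ← ENNReal.ofReal_div_of_pos hv,
    lt_min_iff]
  refine ⟨by simpa [div_lt_one hv] using huv, ?_⟩
  have hq : ENNReal.ofReal (u / v) = ENNReal.ofReal ((u / v) ^ p) ^ (1 / p) := by
    rw [ENNReal.ofReal_rpow_of_pos (by positivity), ← Real.rpow_mul (by positivity),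
      mul_one_div_cancel hp.ne', Real.rpow_one]
  rw [hq]
  refine ENNReal.rpow_lt_rpow (lt_of_lt_of_le ?_ (ENNReal.div_le_div_right hd t)) (by positivity)
  rw [ENNReal.lt_div_iff_mul_lt (Or.inl ht0) (Or.inl ht.ne_top)]
  have hqpos : 0 < (u / v) ^ p := by positivity
  calc ENNReal.ofReal ((u / v) ^ p) * t
      < ENNReal.ofReal ((u / v) ^ p) * ENNReal.ofReal (m * (v / u) ^ p) :=
        ENNReal.mul_lt_mul_right (by simpa using hqpos) ENNReal.ofReal_ne_top ht
    _ = ENNReal.ofReal m := by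
        rw [← ENNReal.ofReal_mul hqpos.le, mul_left_comm, ← Real.mul_rpow (by positivity)
          (by positivity), show u / v * (v / u) = 1 by field_simp, Real.one_rpow, mul_one]

theorem rearr_weakMaximal_le {Y : Type*} [MeasurableSpace Y] {ν : Measure Y}
    {τ : Y → ℝ≥0∞} (hτ : IsUniformlyDistributed ν τ) {p : ℝ} (hp : 0 < p) (f : Z → ℝ≥0∞) {t : ℝ}
    (ht : 0 < t) :
    rearr ν (fun y => weakMaximal p μ f (τ y)) t ≤ weakMaximal p μ f (ENNReal.ofReal (t / 4)) := by
  refine le_of_forall_gt_imp_ge_of_dense fun s hs => rearr_le (zero_le.trans_lt hs) ?_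
  have h4 := hτ.upper (t / 4) (by positivity)
  rw [mul_div_cancel₀ _ four_ne_zero] at h4
  refine (measure_mono fun y hy => ?_).trans h4
  by_contra hcon
  exact absurd ((show s < _ from hy).trans_le (weakMaximal_antitone hp f (not_lt.1 hcon)))
    (not_lt.2 hs.le)

/-- By monotonicity a value `s` below the left side is exceeded on `{τ < t}`, whose measure is at
least `t/2 > t/4`. With `rearr_weakMaximal_le`, composition with `τ` preserves the rearrangement up
to dilation. -/
theorem weakMaximal_le_rearr {Y : Type*} [MeasurableSpace Y] {ν : Measure Y}
    {τ : Y → ℝ≥0∞} (hτ : IsUniformlyDistributed ν τ) {p : ℝ} (hp : 0 < p) (f : Z → ℝ≥0∞) {t : ℝ}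
    (ht : 0 < t) :
    weakMaximal p μ f (ENNReal.ofReal t) ≤ rearr ν (fun y => weakMaximal p μ f (τ y)) (t / 4) := by
  refine le_sInf fun s hs => ?_
  by_contra! hlt
  have h1 : ENNReal.ofReal (t / 2) ≤ ENNReal.ofReal (t / 4) := by
    refine (hτ.lower t ht).trans ((measure_mono fun y hy => ?_).trans hs.2)
    exact hlt.trans_le (weakMaximal_antitone hp f (show _ < _ from hy).le)
  rw [ENNReal.ofReal_le_ofReal_iff (by positivity)] at h1
  linarith

end WeakMaximal

theorem rearr_congr_ae {Y : Type*} [MeasurableSpace Y] {ν : Measure Y} {f g : Y → ℝ≥0∞}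
    (h : f =ᵐ[ν] g) (t : ℝ) : rearr ν f t = rearr ν g t := by
  have hd : ∀ s, distFun ν f s = distFun ν g s := fun s => by
    refine measure_congr ?_
    filter_upwards [h] with y hy
    exact propext (by rw [show ({x | s < f x} : Set Y) y ↔ s < f y from Iff.rfl, hy]; rfl)
  simp only [rearr, hd]

/-! ### The extremal operator and necessity for the class `W` -/

section Extremal

variable {X Y 𝕜 : Type*} [MeasurableSpace X] [MeasurableSpace Y] [RCLike 𝕜]
  {μ : Measure X} {ν : Measure Y}

/-- The extremal operator `f ↦ weakMaximal f ∘ τ` of the interpolation class. -/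
noncomputable def extremalOperator (p : ℝ) (hp : 0 < p) {τ : Y → ℝ≥0∞}
    (hτ : IsUniformlyDistributed ν τ) (f : X →ₘ[μ] 𝕜) : Y →ₘ[ν] 𝕜 :=
  AEEqFun.mk (fun y => (((weakMaximal p μ (fun x => ‖f x‖ₑ) (τ y)).toReal : ℝ) : 𝕜))
    (RCLike.measurable_ofReal.comp ((weakMaximal_antitone hp _).measurable.comp
      hτ.measurable).ennreal_toReal).aestronglyMeasurable

/-- Functions on which the extremal operator is finite. -/
def FiniteMaximal (p : ℝ) (f : X →ₘ[μ] 𝕜) : Prop :=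
  ∀ t : ℝ≥0∞, t ≠ 0 → weakMaximal p μ (fun x => ‖f x‖ₑ) t ≠ ∞

variable {p : ℝ} {τ : Y → ℝ≥0∞}

/-- Under `FiniteMaximal`, `toReal` loses information only where `τ = 0`, a null set. -/
theorem enorm_extremalOperator (hp : 0 < p) (hτ : IsUniformlyDistributed ν τ) {f : X →ₘ[μ] 𝕜}
    (hf : FiniteMaximal p f) :
    (fun y => ‖extremalOperator p hp hτ f y‖ₑ)
      =ᵐ[ν] fun y => weakMaximal p μ (fun x => ‖f x‖ₑ) (τ y) := by
  filter_upwards [AEEqFun.coeFn_mk (μ := ν) (fun y =>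
    (((weakMaximal p μ (fun x => ‖f x‖ₑ) (τ y)).toReal : ℝ) : 𝕜)) (RCLike.measurable_ofReal.comp
      ((weakMaximal_antitone hp _).measurable.comp hτ.measurable).ennreal_toReal).aestronglyMeasurable,
    hτ.ae_ne_zero] with y hy h0
  rw [extremalOperator, hy, ← ofReal_norm, RCLike.norm_ofReal,
    abs_of_nonneg ENNReal.toReal_nonneg, ENNReal.ofReal_toReal (hf _ h0)]

theorem ae_enorm_add_le (f g : X →ₘ[μ] 𝕜) : ∀ᵐ x ∂μ, ‖(f + g) x‖ₑ ≤ ‖f x‖ₑ + ‖g x‖ₑ := by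
  filter_upwards [AEEqFun.coeFn_add f g] with x hx
  rw [hx]
  exact enorm_add_le _ _

theorem FiniteMaximal.add (hp : 0 < p) {f g : X →ₘ[μ] 𝕜} (hf : FiniteMaximal p f)
    (hg : FiniteMaximal p g) : FiniteMaximal p (f + g) := fun t ht => by
  have ht2 : t / 2 ≠ 0 := ENNReal.div_ne_zero.2 ⟨ht, by simp⟩
  refine ne_top_of_le_ne_top ?_ (weakMaximal_le_two_mul hp (ae_enorm_add_le f g) t)
  have h1 := hf _ ht2
  have h2 := hg _ ht2
  finiteness

theorem finiteMaximal_of_lorentzInt {r : ℝ} (hp : 0 < p) (hr : 1 ≤ r) {f : X →ₘ[μ] 𝕜}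
    (hf : lorentzInt p r μ f < ∞) : FiniteMaximal p f := fun t ht => by
  refine ne_top_of_le_ne_top ?_ (weakMaximal_le_lorentzInt hp hr f t)
  exact ENNReal.mul_ne_top (ENNReal.mul_ne_top (by simp) hf.ne)
    (ENNReal.rpow_ne_top_of_nonneg (by positivity) (ENNReal.inv_ne_top.2 ht))

theorem weakMaximal_le_eLpNorm (hp : 0 < p) (f : X →ₘ[μ] 𝕜) (t : ℝ≥0∞) :
    weakMaximal p μ (fun x => ‖f x‖ₑ) t ≤ eLpNorm f ∞ μ := by
  refine weakMaximal_le_of_ae_le hp ?_ t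
  rw [eLpNorm_exponent_top]
  exact enorm_ae_le_eLpNormEssSup f μ

theorem finiteMaximal_of_eLpNorm (hp : 0 < p) {f : X →ₘ[μ] 𝕜} (hf : eLpNorm f ∞ μ < ∞) :
    FiniteMaximal p f := fun t _ => ne_top_of_le_ne_top hf.ne (weakMaximal_le_eLpNorm hp f t)

theorem finiteMaximal_of_mem_simpleFunctions (hp : 0 < p) {f : X →ₘ[μ] 𝕜}
    (hf : f ∈ simpleFunctions 𝕜 μ) : FiniteMaximal p f := by
  obtain ⟨s, rfl⟩ := hf
  obtain ⟨C, hC⟩ := s.exists_forall_norm_le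
  refine finiteMaximal_of_eLpNorm hp (lt_of_le_of_lt (b := ENNReal.ofReal C)
    (eLpNorm_top_le_of_ae ?_) ENNReal.ofReal_lt_top)
  filter_upwards [AEEqFun.coeFn_mk (μ := μ) s s.aestronglyMeasurable] with x hx
  rw [hx, ← ofReal_norm]
  exact ENNReal.ofReal_le_ofReal (hC x)

theorem finiteMaximal_of_mem_lorentzSumLinfty {r : ℝ} (hp : 0 < p) (hr : 1 ≤ r) {f : X →ₘ[μ] 𝕜}
    (hf : f ∈ lorentzSumLinfty 𝕜 p r μ) : FiniteMaximal p f := by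
  obtain ⟨g, h, rfl, hg, hh⟩ := hf
  exact (finiteMaximal_of_lorentzInt hp hr hg).add hp (finiteMaximal_of_eLpNorm hp hh)

theorem memW_extremalOperator {r : ℝ} (hp : 0 < p) (hr : 1 ≤ r)
    (hτ : IsUniformlyDistributed ν τ) {D : Set (X →ₘ[μ] 𝕜)}
    (hD : ∀ f ∈ D, FiniteMaximal p f) : MemW D p r (extremalOperator p hp hτ) where
  quasilinear := by
    -- `32 = 4 · 2 · 4`: dilations from `rearr_weakMaximal_le`, `weakMaximal_le_two_mul` and
    -- `weakMaximal_le_rearr`.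
    refine ⟨2, 1 / 32, two_pos, by norm_num, by norm_num, fun f₁ h₁ f₂ h₂ t ht => ?_⟩
    rw [rearr_congr_ae (enorm_extremalOperator hp hτ ((hD f₁ h₁).add hp (hD f₂ h₂))),
      rearr_congr_ae (enorm_extremalOperator hp hτ (hD f₁ h₁)),
      rearr_congr_ae (enorm_extremalOperator hp hτ (hD f₂ h₂)), ENNReal.ofReal_ofNat]
    refine (rearr_weakMaximal_le hτ hp _ ht).trans
      ((weakMaximal_le_two_mul hp (ae_enorm_add_le f₁ f₂) _).trans ?_)
    have e1 : ENNReal.ofReal (t / 4) / 2 = ENNReal.ofReal (t / 8) := by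
      rw [← ENNReal.ofReal_ofNat 2, ← ENNReal.ofReal_div_of_pos two_pos]
      congr 1; ring
    rw [e1, show 1 / 32 * t = t / 8 / 4 by ring]
    gcongr
    · exact weakMaximal_le_rearr hτ hp _ (by positivity)
    · exact weakMaximal_le_rearr hτ hp _ (by positivity)
  weak_type := by
    refine ⟨4 ^ (1 / p) * 2, by positivity, fun f hf l hl => ?_⟩
    have hlE : ENNReal.ofReal l ≠ 0 := by simpa using hl
    have hd : distFun ν (fun y => ‖extremalOperator p hp hτ f y‖ₑ) (ENNReal.ofReal l)
        ≤ 4 * ((2 * lorentzInt p r μ f) ^ p / ENNReal.ofReal l ^ p) := by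
      refine le_trans (measure_mono_ae ?_) (measure_lt_weakMaximal_le (μ := μ) hτ hp hr f hl)
      filter_upwards [enorm_extremalOperator hp hτ (hD f hf)] with y hy hly
      exact (show _ < _ from hly).trans_eq hy
    calc _ ≤ ENNReal.ofReal l *
          (4 * ((2 * lorentzInt p r μ f) ^ p / ENNReal.ofReal l ^ p)) ^ (1 / p) := by gcongr
      _ = _ := by
          rw [← ENNReal.div_rpow_of_nonneg _ _ hp.le, ENNReal.mul_rpow_of_nonneg _ _
            (by positivity), ← ENNReal.rpow_mul, mul_one_div_cancel hp.ne', ENNReal.rpow_one,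
            mul_left_comm, ENNReal.mul_div_cancel hlE ENNReal.ofReal_ne_top,
            ENNReal.ofReal_mul (by positivity), ← ENNReal.ofReal_rpow_of_pos (by norm_num),
            ENNReal.ofReal_ofNat, ENNReal.ofReal_ofNat, mul_assoc]
  bounded := by
    refine ⟨1, one_pos, fun f hf => ?_⟩
    rw [ENNReal.ofReal_one, one_mul]
    refine eLpNorm_top_le_of_ae ?_
    filter_upwards [enorm_extremalOperator hp hτ (hD f hf)] with y hy
    exact hy.trans_le (weakMaximal_le_eLpNorm hp f _)

/-- The class of `a · χ_E`. -/
noncomputable def indicatorClass (𝕜 : Type*) [RCLike 𝕜] (μ : Measure X) {E : Set X}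
    (hE : MeasurableSet E) (a : ℝ) : X →ₘ[μ] 𝕜 :=
  AEEqFun.mk (E.indicator fun _ => (a : 𝕜))
    (stronglyMeasurable_const.indicator hE).aestronglyMeasurable

theorem enorm_indicatorClass {E : Set X} (hE : MeasurableSet E) {a : ℝ} (ha : 0 ≤ a) :
    (fun x => ‖indicatorClass 𝕜 μ hE a x‖ₑ) =ᵐ[μ] E.indicator fun _ => ENNReal.ofReal a := by
  filter_upwards [AEEqFun.coeFn_mk (μ := μ) (E.indicator fun _ => (a : 𝕜))
    (stronglyMeasurable_const.indicator hE).aestronglyMeasurable] with x hx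
  rw [indicatorClass, hx]
  by_cases hxE : x ∈ E
  · rw [indicator_of_mem hxE, indicator_of_mem hxE, ← ofReal_norm, RCLike.norm_ofReal,
      abs_of_nonneg ha]
  · simp [hxE]

theorem indicatorClass_mem_simpleFunctions {E : Set X} (hE : MeasurableSet E) (a : ℝ) :
    indicatorClass 𝕜 μ hE a ∈ simpleFunctions 𝕜 μ := by
  refine ⟨(SimpleFunc.const X (a : 𝕜)).restrict E, AEEqFun.mk_eq_mk.2 ?_⟩
  rw [SimpleFunc.coe_restrict _ hE]
  rfl

theorem indicatorClass_mem_lorentzSumLinfty {r : ℝ} (hp : 1 ≤ p) (hpr : p ≤ r) {E : Set X}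
    (hE : MeasurableSet E) {a : ℝ} (ha : 0 ≤ a) :
    indicatorClass 𝕜 μ hE a ∈ lorentzSumLinfty 𝕜 p r μ := by
  have hp0 : 0 < p := by linarith
  refine ⟨0, _, (zero_add _).symm, ?_, lt_of_le_of_lt (b := ENNReal.ofReal a)
    (eLpNorm_top_le_of_ae ?_) ENNReal.ofReal_lt_top⟩
  · refine (lorentzInt_le hp hpr (AEEqFun.measurable _)).trans_lt ?_
    have : ∫⁻ x, ‖(0 : X →ₘ[μ] 𝕜) x‖ₑ ^ p ∂μ = 0 := by
      rw [← lintegral_zero (μ := μ)]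
      refine lintegral_congr_ae ?_
      filter_upwards [AEEqFun.coeFn_zero (α := X) (β := 𝕜) (μ := μ)] with x hx
      simp [hx, hp0]
    rw [this, ENNReal.zero_rpow_of_pos (by positivity)]
    exact ENNReal.zero_lt_top
  · filter_upwards [enorm_indicatorClass (𝕜 := 𝕜) (μ := μ) hE ha] with x hx
    rw [hx]
    exact indicator_apply_le fun _ => le_rfl

theorem BoundedOn.densityCondition [SigmaFinite μ] [SigmaFinite ν] (hμ : μ univ = ∞)
    (hν : ν univ = ∞) (hμa : IsNonatomic μ) (hνa : IsNonatomic ν) {D : Set (X →ₘ[μ] 𝕜)} {r : ℝ}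
    (hp : 1 ≤ p) (hpr : p ≤ r) (hD : ∀ f ∈ D, FiniteMaximal p f)
    (hDE : ∀ E (hE : MeasurableSet E) (a : ℝ), 0 ≤ a → indicatorClass 𝕜 μ hE a ∈ D)
    {φ₁ φ₂ : ℝ → ℝ≥0∞} {Φ₁ Φ₂ : ℝ≥0∞ → ℝ≥0∞} (h₁ : IsMonotoneDensity φ₁ Φ₁)
    (h₂ : IsMonotoneDensity φ₂ Φ₂) (h : BoundedOn D ν p r Φ₁ Φ₂) :
    DensityCondition p φ₁ Φ₂ := by
  have hp0 : 0 < p := by linarith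
  obtain ⟨τ, hτ⟩ := hνa.exists_isUniformlyDistributed hν
  set T : (X →ₘ[μ] 𝕜) → (Y →ₘ[ν] 𝕜) := extremalOperator p hp0 hτ
  obtain ⟨C, hC, hT⟩ := h T (memW_extremalOperator hp0 (hp.trans hpr) hτ hD)
  -- The test function is `a χ_E` with `a = 2(C+1)b`: after division by `C + 1` its height still
  -- strictly exceeds `b`. The `4` is `2/m` with `m = 1/(2x)`, `x` approximating `Φ₂(a)` from above.
  refine ⟨4, 2 * (C + 1), by norm_num, by positivity, fun b hb => ?_⟩
  set a : ℝ := 2 * (C + 1) * b with ha_def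
  have ha : 0 < a := by positivity
  rw [ENNReal.ofReal_ofNat]
  -- Replacing `Φ₂(a)` by a larger real `x > 0` covers `Φ₂(a) = 0`, when no normalisation by
  -- `1/Φ₂(a)` is possible; if `Φ₂(a) = ∞` there is nothing to prove.
  refine le_of_forall_gt_imp_ge_of_dense fun z hz => ?_
  rcases eq_or_ne z ∞ with rfl | hztop
  · exact le_top
  obtain ⟨x, hx, rfl⟩ : ∃ x : ℝ, 0 < x ∧ z = 4 * ENNReal.ofReal x :=
    ⟨z.toReal / 4, div_pos (ENNReal.toReal_pos (ne_bot_of_gt hz) hztop) (by norm_num), by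
      rw [← ENNReal.ofReal_ofNat 4, ← ENNReal.ofReal_mul (by norm_num),
        mul_div_cancel₀ _ four_ne_zero, ENNReal.ofReal_toReal hztop]⟩
  have hΦx : Φ₂ (ENNReal.ofReal a) ≤ ENNReal.ofReal x :=
    ((ENNReal.mul_lt_mul_iff_right (by simp) (by simp)).1 hz).le
  -- `μ E` is known only up to a factor `2`; this `m` ensures `Φ₂(a) μ E ≤ 1`.
  set m : ℝ := 1 / (2 * x) with hm_def
  have hm : 0 < m := by positivity
  obtain ⟨E, hE, hmE, hEm⟩ := hμa.exists_measure_mem_Icc hμ (m := ENNReal.ofReal m)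
    (by simpa using hm) ENNReal.ofReal_ne_top
  set f : X →ₘ[μ] 𝕜 := indicatorClass 𝕜 μ hE a
  have hfD : f ∈ D := hDE E hE a ha.le
  have hfn := enorm_indicatorClass (𝕜 := 𝕜) (μ := μ) hE ha.le
  have hfint : ∫⁻ x, Φ₂ ‖f x‖ₑ ∂μ ≤ 1 := by
    calc ∫⁻ x, Φ₂ ‖f x‖ₑ ∂μ = ∫⁻ x, E.indicator (fun _ => Φ₂ (ENNReal.ofReal a)) x ∂μ := by
          refine lintegral_congr_ae ?_
          filter_upwards [hfn] with x hx
          rw [hx]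
          by_cases hxE : x ∈ E <;> simp [hxE, h₂.young_zero]
      _ = Φ₂ (ENNReal.ofReal a) * μ E := lintegral_indicator_const hE _
      _ ≤ ENNReal.ofReal x * (2 * ENNReal.ofReal m) := mul_le_mul' hΦx hEm
      _ = 1 := by
          rw [← ENNReal.ofReal_ofNat 2, ← ENNReal.ofReal_mul (by norm_num),
            ← ENNReal.ofReal_mul hx.le, hm_def, ← ENNReal.ofReal_one]
          congr 1; field_simp
  have hgauge : gaugeNorm Φ₂ μ f ≤ 1 :=
    sInf_le ⟨one_pos, ENNReal.one_lt_top, by simpa using hfint⟩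
  have hfO : f ∈ orliczClass 𝕜 Φ₂ μ :=
    ⟨1, one_pos, by simpa using hfint.trans_lt ENNReal.one_lt_top⟩
  -- The strict inequality yields an admissible `k < C + 1` without knowing that the infimum is
  -- attained.
  have hgT : gaugeNorm Φ₁ ν (T f) < ENNReal.ofReal (C + 1) := by
    calc _ ≤ ENNReal.ofReal C * gaugeNorm Φ₂ μ f := hT f hfD hfO
      _ ≤ ENNReal.ofReal C := mul_le_of_le_one_right zero_le hgauge
      _ < _ := (ENNReal.ofReal_lt_ofReal_iff (by positivity)).2 (by linarith)
  obtain ⟨k, ⟨-, -, hk⟩, hkC⟩ := sInf_lt_iff.1 hgT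
  have hTint : ∫⁻ y, Φ₁ (‖T f y‖ₑ / ENNReal.ofReal (C + 1)) ∂ν ≤ 1 :=
    (lintegral_mono fun y => h₁.young_mono (ENNReal.div_le_div_left hkC.le _)).trans hk
  have hlow := (h₁.mul_lintegral_density_le (ν := ν) (p := p) (b := b)
    ((T f).measurable.enorm.div_const (ENNReal.ofReal (C + 1))) (ENNReal.ofReal (m / 2))
    (fun u hu hub => by
      rw [← ENNReal.ofReal_mul (by positivity), show m / 2 * (b / u) ^ p
        = m * (b / u) ^ p / 2 by ring]
      refine (hτ.lower _ (by positivity)).trans (measure_mono_ae ?_)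
      filter_upwards [enorm_extremalOperator hp0 hτ (hD f hfD), hτ.ae_ne_zero] with y hy hy0 hyτ
      show ENNReal.ofReal u < ‖T f y‖ₑ / ENNReal.ofReal (C + 1)
      rw [lt_div_ofReal_iff (by positivity)]
      refine lt_of_lt_of_eq (lt_weakMaximal hp0 (v := b * (C + 1)) (m := m) (by positivity)
        (by gcongr) ?_ hy0 ?_) hy.symm
      · refine hmE.trans (measure_mono_ae ?_)
        filter_upwards [hfn] with w hw hwE
        show _ < ‖f w‖ₑ
        rw [hw, indicator_of_mem hwE, ENNReal.ofReal_lt_ofReal_iff ha, ha_def]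
        nlinarith [mul_pos hb (show 0 < C + 1 by positivity)]
      · rw [mul_div_mul_right _ _ (by positivity)]
        exact hyτ)).trans hTint
  rw [mul_comm, ← ENNReal.le_div_iff_mul_le (Or.inl (by simpa using hm)) (by simp)] at hlow
  refine hlow.trans (le_of_eq ?_)
  rw [← ENNReal.ofReal_ofNat 4, ← ENNReal.ofReal_mul (by norm_num), ← ENNReal.ofReal_one,
    ← ENNReal.ofReal_div_of_pos (by positivity), hm_def]
  congr 1; field_simp; norm_num

end Extremal

end OrliczInterp

/-! ### Assembly of the equivalences around the density condition -/

theorem mainTheorem3 {X Y : Type*} (𝕜 : Type*) [RCLike 𝕜]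
    [MeasurableSpace X] [MeasurableSpace Y] (μ : Measure X) (ν : Measure Y)
    [SigmaFinite μ] [SigmaFinite ν] (hμ : μ univ = ∞) (hν : ν univ = ∞)
    (hν_nonatomic : OrliczInterp.IsNonatomic ν) (hν_separable : IsSeparable ν)
    (p r : ℝ) (hp : 1 < p) (hpr : p ≤ r)
    (Φ₁ Φ₂ : ℝ≥0∞ → ℝ≥0∞)
    (hΦ₁ : OrliczInterp.IsYoungFunction Φ₁) (hΦ₂ : OrliczInterp.IsYoungFunction Φ₂) :
    (OrliczInterp.ModularInequality p r Φ₁ Φ₂ ↔ OrliczInterp.ZygmundStromberg p Φ₁ Φ₂) ∧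
    (OrliczInterp.ZygmundStromberg p Φ₁ Φ₂ →
      OrliczInterp.BoundedSimple 𝕜 μ ν p r Φ₁ Φ₂ ∧
      OrliczInterp.BoundedFull 𝕜 μ ν p r Φ₁ Φ₂) ∧
    (OrliczInterp.IsNonatomic μ →
      List.TFAE [
        OrliczInterp.BoundedSimple 𝕜 μ ν p r Φ₁ Φ₂,
        OrliczInterp.BoundedFull 𝕜 μ ν p r Φ₁ Φ₂,
        OrliczInterp.ModularInequality p r Φ₁ Φ₂,
        OrliczInterp.ZygmundStromberg p Φ₁ Φ₂]) := by
  obtain ⟨φ₁, h₁⟩ := hΦ₁.exists_density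
  obtain ⟨φ₂, h₂⟩ := hΦ₂.exists_density
  have hp0 : 0 < p := by linarith
  have hr : 1 ≤ r := hp.le.trans hpr
  have hmod : OrliczInterp.ModularInequality p r Φ₁ Φ₂ ↔
      OrliczInterp.ZygmundStromberg p Φ₁ Φ₂ :=
    ⟨fun h => (h.densityCondition hp.le hpr h₁ h₂).zygmundStromberg h₁,
      fun h => (h.densityCondition hp0 h₁).modularInequality hp.le hpr h₁ h₂⟩
  have hbdd : OrliczInterp.ZygmundStromberg p Φ₁ Φ₂ →
      OrliczInterp.BoundedSimple 𝕜 μ ν p r Φ₁ Φ₂ ∧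
      OrliczInterp.BoundedFull 𝕜 μ ν p r Φ₁ Φ₂ := fun h => by
    have hd := h.densityCondition hp0 h₁
    exact ⟨hd.boundedOn OrliczInterp.indicatorStable_simpleFunctions hp.le hpr h₁ h₂,
      hd.orliczClass_subset hp.le hpr h₁, hd.boundedOn
        (OrliczInterp.indicatorStable_lorentzSumLinfty hp0 (by linarith)) hp.le hpr h₁ h₂⟩
  refine ⟨hmod, hbdd, fun hμa => ?_⟩
  tfae_have 3 ↔ 4 := hmod
  tfae_have 4 → 1 := fun h => (hbdd h).1
  tfae_have 4 → 2 := fun h => (hbdd h).2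
  tfae_have 1 → 4 := fun h => (OrliczInterp.BoundedOn.densityCondition hμ hν hμa hν_nonatomic
    hp.le hpr (fun _ => OrliczInterp.finiteMaximal_of_mem_simpleFunctions hp0)
    (fun _ hE a _ => OrliczInterp.indicatorClass_mem_simpleFunctions hE a) h₁ h₂
      h).zygmundStromberg h₁
  tfae_have 2 → 4 := fun h => (OrliczInterp.BoundedOn.densityCondition hμ hν hμa hν_nonatomic
    hp.le hpr (fun _ => OrliczInterp.finiteMaximal_of_mem_lorentzSumLinfty hp0 hr)
    (fun _ hE _ ha => OrliczInterp.indicatorClass_mem_lorentzSumLinfty hp.le hpr hE ha) h₁ h₂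
      h.2).zygmundStromberg h₁
  tfae_finish
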